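/- **Setting.** All signals are vector-valued, indexed by $t\in\mathbb Z$, with bounded second moments. Write $\bar{\mathbb E}f=\lim_{N\to\infty}\frac1N\sum_{t=1}^N\mathbb E f(t)$. A signal $s$ is quasi-stationary if its correlations $R_s(\tau)=\bar{\mathbb E}\,s(t)s(t-\tau)^T$ exist for all $\tau\in\mathbb Z$. Its spectrum, if it exists, is the integrable matrix function $\Phi_s$ with $R_s(\tau)=\frac1{2\pi}\int_{-\pi}^{\pi}\Phi_s(\omega)e^{i\omega\tau}d\omega$. Two signals are uncorrelated if their cross-correlations vanish at every lag. Transfer functions are real, rational, proper and stable, unless said otherwise. The data are generated by $y(t)=G^0(q)u(t)+H^0(q)e(t)$ with $y(t),e(t)\in\mathbb R^p$ and $u(t)\in\mathbb R^m$, where $G^0$ is stable, $H^0$ is monic, stable and stably invertible, and $e$ is white noise. The situation is open loop: $u$ and $e$ are uncorrelated. The input satisfies $$u(t)=G_u(q)u(t)+R_u x(t),$$ where $G_u$ is proper, stable and hollow (zero diagonal), $I-G_u$ is invertible as a rational matrix, and $R_u$ consists of distinct columns of the $m\times m$ identity matrix. The spectrum $\Phi_x(\omega)$ is diagonal and positive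 definite for all $\omega$, and $(x,u,e)$ is jointly quasi-stationary. The model set is $(G(q,\theta),H(q,\theta))_{\theta\in\Theta}$, $\Theta\subseteq\mathbb R^n$, with $G(\cdot,\theta)$ stable and $H(\cdot,\theta)$ monic, stable and stably invertible. It contains the true system: $(G,H)(\cdot,\theta_0)=(G^0,H^0)$ for some $\theta_0\in\Theta$. The prediction error is $\varepsilon(t,\theta)=y(t)-\hat y(t|t-1;\theta)$, where $\hat y(t|t-1;\theta)=(I-H(q,\theta)^{-1})y(t)+H(q,\theta)^{-1}G(q,\theta)u(t)$, and the cost is $V(\theta)=\bar{\mathbb E}\|\varepsilon(t,\theta)\|^2$. Fix an output index $j$. Let $\kappa_u^{[j]}$ and $\kappa_e^{[j]}$ be the components of $u$ and of $e$ that belong to the parametrized entries of row $j$ of $M(q,\theta)=[\,G(q,\theta)\ \ H(q,\theta)\,]$; the other entries of row $j$ do not depend on $\theta\in\Theta$. Let $u_i$ be a component of $\kappa_u^{[j]}$. The graph of the input network has the components of $u$ and $x$ as vertices. It has an edge $u_k\to u_\ell$ iff $[G_u]_{\ell k}\ne0$ and an edge $x_k\to u_\ell$ iff $[R_u]_{\ell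 k}\neq0$. Let $u_{\mathcal D^c}$ be a set of components of $u$ not containing $u_i$ that is a disconnecting set from $u_i$ to the other components of $\kappa_u^{[j]}$; that is, after removal of $u_{\mathcal D^c}$ from the graph there is no directed path from $u_i$ to any of these components. Let $u_{\mathcal T}$ consist of the components of $\kappa_u^{[j]}$ that are neither $u_i$ nor in $u_{\mathcal D^c}$. Let $x_{\mathcal T^*}$ consist of the components of $x$ that have a path to a vertex of $u_{\mathcal T}$ not passing through $u_{\mathcal D^c}$. **Theorem 1.** Suppose that row $j$ of $M(q,\theta)$ shares no parameters with the other rows, and that the entries of row $j$ of $G(q,\theta)$ in the columns of $u_{i\cup\mathcal D^c}$ share no parameters with those in the columns of $u_{\mathcal T}$. Let $u_{(i\cup\mathcal D^c)\perp x_{\mathcal T^*}}$ be the projection of the signals $u_{i\cup\mathcal D^c}$ onto the orthogonal complement of $x_{\mathcal T^*}$: it is uncorrelated with $x_{\mathcal T^*}$, and its difference from $u_{i\cup\mathcal D^c}$ lies in the closed linear span of the time shifts of $x_{\mathcal T^*}$, in the mean power seminorm. If $$\mu^{[j]}=\begin{bmatrix}u_{(i\cup\mathcal D^c)\perp x_{\mathcal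 T^*}}\\ \kappa_e^{[j]}\end{bmatrix}$$ has a spectrum with $\Phi_{\mu^{[j]}}(\omega)\succ0$ for almost all $\omega$, then $G_{ji}$ is unique in the minimum of the cost: $V(\theta)$ is well defined for all $\theta\in\Theta$, every $\theta\in\Theta$ with $(G,H)(\cdot,\theta)=(G^0,H^0)$ minimizes $V$ over $\Theta$, and every minimizer $\theta^*\in\Theta$ of $V$ over $\Theta$ satisfies $G_{ji}(q,\theta^*)=G^0_{ji}(q)$. -/

import Mathlib

open MeasureTheory Filter Topology
open scoped ComplexOrder

/-! ### Transfer functions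

A rational transfer function is an element of `RatFunc ℝ`. The indeterminate stands for the
delay operator `q⁻¹`, i.e. for `1/z`. A proper rational function of `z` without poles in
`|z| ≥ 1` is the same thing as a rational function of `q⁻¹` without poles in the closed unit
disc (the absence of a pole at `q⁻¹ = 0` is properness). -/

/-- Proper and stable: no pole in the closed unit disc of the variable `q⁻¹`. -/
def IsStable (F : RatFunc ℝ) : Prop :=
  ∀ z : ℂ, ‖z‖ ≤ 1 → Polynomial.aeval z F.denom ≠ 0

/-- A transfer matrix is (proper and) stable if all its entries are. -/
def IsStableMatrix {α β : Type*} (F : Matrix α β (RatFunc ℝ)) : Prop :=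
  ∀ a b, IsStable (F a b)

/-- The impulse response `g(0), g(1), …` of `F = ∑ g(k) q^{-k}`. -/
noncomputable def impulse (F : RatFunc ℝ) (k : ℕ) : ℝ :=
  (F : LaurentSeries ℝ).coeff (k : ℤ)

/-- Monic: the direct feedthrough term is the identity matrix. -/
def IsMonic {α : Type*} [DecidableEq α] (F : Matrix α α (RatFunc ℝ)) : Prop :=
  ∀ a b, impulse (F a b) 0 = (1 : Matrix α α ℝ) a b

/-- An admissible noise model: monic, stable and stably invertible. -/
structure IsNoiseModel {α : Type*} [Fintype α] [DecidableEq α]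
    (H : Matrix α α (RatFunc ℝ)) : Prop where
  monic : IsMonic H
  stable : IsStableMatrix H
  stable_inv : IsStableMatrix H⁻¹

/-! ### Signals, generalized expectation, spectra -/

section Signals

variable {Ω : Type*} [MeasurableSpace Ω]

/-- The filtered signal `F(q) s(t)`, with components `∑_b ∑_{k ≥ 0} g_{ab}(k) s_b(t-k)`. -/
noncomputable def filt {α β : Type*} [Fintype β] (F : Matrix α β (RatFunc ℝ))
    (s : ℤ → Ω → β → ℝ) : ℤ → Ω → α → ℝ :=
  fun t ω a => ∑ b, ∑' k : ℕ, impulse (F a b) k * s (t - (k : ℤ)) ω b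

/-- `(1/N) ∑_{t=1}^N E f(t)`. -/
noncomputable def timeAvg (P : Measure Ω) (f : ℤ → Ω → ℝ) (N : ℕ) : ℝ :=
  (N : ℝ)⁻¹ * ∑ t ∈ Finset.Icc 1 N, ∫ ω, f (t : ℤ) ω ∂P

/-- The generalized expectation of `f` exists and equals `a`:
`lim_{N → ∞} (1/N) ∑_{t=1}^N E f(t) = a`. -/
def HasGenExp (P : Measure Ω) (f : ℤ → Ω → ℝ) (a : ℝ) : Prop :=
  Tendsto (timeAvg P f) atTop (𝓝 a)

/-- Quasi-stationary vector signals: second moments exist and are bounded, and the correlations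
at every lag have a generalized expectation. -/
structure IsQuasiStationary {ι : Type*} (P : Measure Ω) (s : ℤ → Ω → ι → ℝ) : Prop where
  memLp : ∀ t k, MemLp (fun ω => s t ω k) 2 P
  bounded : ∃ C : ℝ, ∀ t k, ∫ ω, (s t ω k) ^ 2 ∂P ≤ C
  correlation : ∀ (τ : ℤ) (k l : ι),
    ∃ r : ℝ, HasGenExp P (fun t ω => s t ω k * s (t - τ) ω l) r

/-- Two signals are uncorrelated if their cross-correlation vanishes at every lag. -/
def Uncorrelated {ι κ : Type*} (P : Measure Ω) (s : ℤ → Ω → ι → ℝ) (w : ℤ → Ω → κ → ℝ) : Prop :=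
  ∀ (τ : ℤ) (k : ι) (l : κ), HasGenExp P (fun t ω => s t ω k * w (t - τ) ω l) 0

/-- (Wide-sense) vector white noise with some covariance matrix `Λ`. -/
def IsWhiteNoise {ι : Type*} (P : Measure Ω) (e : ℤ → Ω → ι → ℝ) : Prop :=
  (∀ t k, MemLp (fun ω => e t ω k) 2 P) ∧ (∀ t k, ∫ ω, e t ω k ∂P = 0) ∧
    ∃ Λ : Matrix ι ι ℝ, ∀ t t' k l,
      ∫ ω, e t ω k * e t' ω l ∂P = if t = t' then Λ k l else 0

/-- `Φ` is the spectral density of the quasi-stationary signal `s`: it is integrable over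
`[-π, π]` and the correlation matrix at lag `τ` is `(1/2π) ∫ Φ(ω) e^{iωτ} dω`, so that
`Φ(ω) = ∑_τ R(τ) e^{-iωτ}`. -/
structure IsSpectrum {ι : Type*} (P : Measure Ω) (s : ℤ → Ω → ι → ℝ)
    (Φ : ℝ → Matrix ι ι ℂ) : Prop where
  quasiStationary : IsQuasiStationary P s
  integrable : ∀ k l, IntervalIntegrable (fun w => Φ w k l) volume (-Real.pi) Real.pi
  correlation : ∀ (τ : ℤ) (k l : ι), ∃ r : ℝ,
    HasGenExp P (fun t ω => s t ω k * s (t - τ) ω l) r ∧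
    (r : ℂ) = (2 * Real.pi : ℂ)⁻¹ *
      ∫ w in (-Real.pi)..Real.pi, Φ w k l * Complex.exp (Complex.I * w * τ)

/-- `v` is the projection of the signals `s` onto the orthogonal complement of the signals
`x_l`, `l ∈ A`: every component of `v` is uncorrelated with these signals, and every component of
`s - v` lies in the closed linear span of their time shifts; closeness is measured by the mean
power `limsup_N (1/N) ∑_{t=1}^N E(·)²`. -/
structure IsOrthProjection {ι κ : Type*} (P : Measure Ω) (s : ℤ → Ω → ι → ℝ)
    (x : ℤ → Ω → κ → ℝ) (A : Set κ) (v : ℤ → Ω → ι → ℝ) : Prop where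
  quasiStationary : IsQuasiStationary P v
  orthogonal : ∀ (a : ι), ∀ l ∈ A, ∀ τ : ℤ,
    HasGenExp P (fun t ω => v t ω a * x (t - τ) ω l) 0
  closure : ∀ (a : ι) (δ : ℝ), 0 < δ → ∃ c : (A × ℤ) →₀ ℝ, ∀ᶠ N in atTop,
    timeAvg P (fun t ω =>
      (s t ω a - v t ω a - c.sum (fun b r => r * x (t - b.2) ω b.1)) ^ 2) N ≤ δ

/-- The one-step-ahead predictor `ŷ = (I - H⁻¹) y + H⁻¹ G u`. -/
noncomputable def predictor {p m : ℕ} (G : Matrix (Fin p) (Fin m) (RatFunc ℝ))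
    (H : Matrix (Fin p) (Fin p) (RatFunc ℝ)) (y : ℤ → Ω → Fin p → ℝ)
    (u : ℤ → Ω → Fin m → ℝ) : ℤ → Ω → Fin p → ℝ :=
  fun t ω => filt (1 - H⁻¹) y t ω + filt (H⁻¹ * G) u t ω

/-- The one-step-ahead prediction error `ε = y - ŷ`. -/
noncomputable def predError {p m : ℕ} (G : Matrix (Fin p) (Fin m) (RatFunc ℝ))
    (H : Matrix (Fin p) (Fin p) (RatFunc ℝ)) (y : ℤ → Ω → Fin p → ℝ)
    (u : ℤ → Ω → Fin m → ℝ) : ℤ → Ω → Fin p → ℝ :=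
  fun t ω => y t ω - predictor G H y u t ω

end Signals

/-! ### The graph of the input network -/

/-- Edges of the graph with vertices `u_k` (`Sum.inl k`) and `x_k` (`Sum.inr k`). -/
def netEdge {m nx : ℕ} (Gu : Matrix (Fin m) (Fin m) (RatFunc ℝ))
    (Ru : Matrix (Fin m) (Fin nx) ℝ) : Fin m ⊕ Fin nx → Fin m ⊕ Fin nx → Prop
  | Sum.inl k, Sum.inl l => Gu l k ≠ 0
  | Sum.inr k, Sum.inl l => Ru l k ≠ 0
  | _, Sum.inr _ => False

/-- There is a directed path from `a` to `b` in the graph from which the vertices in `D` have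
been removed. -/
def PathAvoiding {V : Type*} (E : V → V → Prop) (D : Set V) (a b : V) : Prop :=
  a ∉ D ∧ b ∉ D ∧ Relation.ReflTransGen (fun v w => E v w ∧ v ∉ D ∧ w ∉ D) a b

/-- `D` is a disconnecting set from `V₁` to `V₂`. -/
def IsDisconnecting {V : Type*} (E : V → V → Prop) (D V₁ V₂ : Set V) : Prop :=
  ∀ a ∈ V₁, ∀ b ∈ V₂, ¬ PathAvoiding E D a b

/-- The (indices of the) external signals that have a path to some `u_k`, `k ∈ T`, without
passing through `u_k`, `k ∈ D`. -/
def xStar {m nx : ℕ} (Gu : Matrix (Fin m) (Fin m) (RatFunc ℝ))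
    (Ru : Matrix (Fin m) (Fin nx) ℝ) (D T : Finset (Fin m)) : Set (Fin nx) :=
  {k | ∃ l ∈ T, PathAvoiding (netEdge Gu Ru) (Sum.inl '' (D : Set (Fin m)))
    (Sum.inr k) (Sum.inl l)}

/-! ### Parametrizations -/

/-- Over `Θ`, the object `f θ` depends only on the parameters `θ_k`, `k ∈ I`. -/
def DependsOnlyOn {n : ℕ} {α : Type*} (Θ : Set (Fin n → ℝ)) (I : Set (Fin n))
    (f : (Fin n → ℝ) → α) : Prop :=
  ∀ θ ∈ Θ, ∀ θ' ∈ Θ, (∀ k ∈ I, θ k = θ' k) → f θ = f θ'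

/-- `f` and `g` are independently parametrized: they share no parameters. -/
def IndepParam {n : ℕ} {α β : Type*} (Θ : Set (Fin n → ℝ))
    (f : (Fin n → ℝ) → α) (g : (Fin n → ℝ) → β) : Prop :=
  ∃ I : Set (Fin n), DependsOnlyOn Θ I f ∧ DependsOnlyOn Θ Iᶜ g

/-!
The scalar signals with bounded second moments form the Banach space `Sig (Lp ℝ 2 P)` of bounded
two-sided sequences in `L²(P)`. The impulse response of a stable transfer function is absolutely
summable (`summable_impulse`), so the ring `stableRing` of stable transfer functions acts on this
space, and the pathwise filter `filt` agrees almost surely with that action (`Represents.filter`).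
The limit of the time-averaged inner products along a nonprincipal ultrafilter is a shift-invariant
positive semidefinite form `powerInner` on the whole space. It equals the generalized expectation
whenever the latter exists, and it allows orthogonality arguments without asking which correlations
exist.

The prediction error is `H⁻¹(G⁰ - G) u + H⁻¹H⁰ e`. In open loop the powers of the two terms add,
and the second one is at least the power of `e`, because `H⁻¹H⁰` is monic and `e` is white
(`powerInner_error_eq`). Hence the true system attains the minimum, and at a minimizer
`H⁻¹(G⁰ - G) u` has zero power; applying `H` and reading row `j` shows that
`∑ₖ (G⁰ⱼₖ - Gⱼₖ) uₖ` has zero power, a relation that involves only the inputs at `i`, `Dc` and `T`.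

Such a relation cannot involve `i` (`coefficient_eq_zero_of_isNull`). Work modulo the closed span of
the shifts of the external signals in `x_{T*}`. There the inputs at `i` and `Dc` coincide with their
projections, which admit no filtered dependency because their spectrum is positive definite
(`eq_zero_of_isNull_of_posDef`). The nodes that reach `T` around `Dc` form a subnetwork that does
not contain `i` and is driven by `Dc` alone, so linear algebra over the domain `stableRing`
eliminates them (`coefficient_eq_zero_of_network`).
-/

/-! ### Stable transfer functions and their impulse responses -/

theorem summable_norm_coeff_mul {K : Type*} [NormedCommRing K] [CompleteSpace K]
    {A B : PowerSeries K} (hA : Summable fun k => ‖PowerSeries.coeff k A‖)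
    (hB : Summable fun k => ‖PowerSeries.coeff k B‖) :
    Summable fun k => ‖PowerSeries.coeff k (A * B)‖ := by
  refine (summable_norm_sum_mul_antidiagonal_of_summable_norm hA hB).congr fun k => ?_
  rw [PowerSeries.coeff_mul]

theorem summable_norm_coeff_polynomial {K : Type*} [NormedCommRing K] (p : Polynomial K) :
    Summable fun k => ‖PowerSeries.coeff k (p : PowerSeries K)‖ := by
  refine summable_of_hasFiniteSupport ((Finset.finite_toSet p.support).subset fun k hk => ?_)
  simpa using hk

/-- The reciprocal of a complex polynomial without zeros in the closed unit disc has absolutely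
summable Taylor coefficients: each linear factor contributes a convergent geometric series. -/
theorem exists_summable_inverse (d : Polynomial ℂ) (hd : ∀ z : ℂ, ‖z‖ ≤ 1 → d.eval z ≠ 0) :
    ∃ Q : PowerSeries ℂ, (d : PowerSeries ℂ) * Q = 1 ∧
      Summable fun k => ‖PowerSeries.coeff k Q‖ := by
  have hd0 : d ≠ 0 := by
    rintro rfl
    exact hd 0 (by simp) (by simp)
  have key : ∀ s : Multiset ℂ, (∀ a ∈ s, 1 < ‖a‖) →
      ∃ Q : PowerSeries ℂ, (((s.map fun a => Polynomial.X - Polynomial.C a).prod :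
        Polynomial ℂ) : PowerSeries ℂ) * Q = 1 ∧
        Summable fun k => ‖PowerSeries.coeff k Q‖ := by
    intro s
    induction s using Multiset.induction_on with
    | empty =>
      intro _
      refine ⟨1, by simp, ?_⟩
      simpa using summable_norm_coeff_polynomial (1 : Polynomial ℂ)
    | cons a s ih =>
      intro hs
      obtain ⟨Q, hQ, hQs⟩ := ih fun b hb => hs b (Multiset.mem_cons_of_mem hb)
      have ha : 1 < ‖a‖ := hs a (Multiset.mem_cons_self a s)
      have ha0 : a ≠ 0 := by
        rintro rfl
        norm_num at ha
      let v : ℂˣ := Units.mk0 a ha0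
      have hv := PowerSeries.invUnitsSub_mul_sub v
      refine ⟨-PowerSeries.invUnitsSub v * Q, ?_, summable_norm_coeff_mul ?_ hQs⟩
      · have hc : ((Polynomial.X - Polynomial.C a : Polynomial ℂ) : PowerSeries ℂ)
            = -(PowerSeries.C (v : ℂ) - PowerSeries.X) := by simp [v]
        rw [Multiset.map_cons, Multiset.prod_cons, Polynomial.coe_mul, hc]
        linear_combination PowerSeries.invUnitsSub v * (PowerSeries.C (v : ℂ) -
          PowerSeries.X) * hQ + hv
      · have hg : Summable fun k : ℕ => ‖a‖⁻¹ * ‖a‖⁻¹ ^ k :=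
          (summable_geometric_of_lt_one (by positivity) (inv_lt_one_of_one_lt₀ ha)).mul_left _
        refine hg.congr fun k => ?_
        simp [PowerSeries.coeff_invUnitsSub, divp, v, pow_succ, mul_comm]
  obtain ⟨Q, hQ, hQs⟩ := key d.roots fun a ha => by
    by_contra h
    exact hd a (not_lt.1 h) (Polynomial.isRoot_of_mem_roots ha)
  have hsplit := (IsAlgClosed.splits d).eq_prod_roots
  have hl : d.leadingCoeff ≠ 0 := Polynomial.leadingCoeff_ne_zero.2 hd0
  refine ⟨PowerSeries.C d.leadingCoeff⁻¹ * Q, ?_, summable_norm_coeff_mul ?_ hQs⟩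
  · have hC : (PowerSeries.C d.leadingCoeff : PowerSeries ℂ) * PowerSeries.C d.leadingCoeff⁻¹
        = 1 := by rw [← map_mul, mul_inv_cancel₀ hl, map_one]
    have hd' := congrArg (fun p : Polynomial ℂ => (p : PowerSeries ℂ)) hsplit
    simp only [Polynomial.coe_mul, Polynomial.coe_C] at hd'
    linear_combination PowerSeries.C d.leadingCoeff⁻¹ * Q * hd' +
      PowerSeries.C d.leadingCoeff * PowerSeries.C d.leadingCoeff⁻¹ * hQ + hC
  · rw [← Polynomial.coe_C]
    exact summable_norm_coeff_polynomial _

theorem isStable_algebraMap (p : Polynomial ℝ) :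
    IsStable (algebraMap (Polynomial ℝ) (RatFunc ℝ) p) := by
  intro z _
  simp [RatFunc.denom_algebraMap]

theorem IsStable.of_denom_dvd {F : RatFunc ℝ} {q : Polynomial ℝ} (h : F.denom ∣ q)
    (hq : ∀ z : ℂ, ‖z‖ ≤ 1 → Polynomial.aeval z q ≠ 0) : IsStable F := by
  intro z hz h0
  obtain ⟨r, rfl⟩ := h
  exact hq z hz (by rw [map_mul, h0, zero_mul])

theorem IsStable.mul {F F' : RatFunc ℝ} (h : IsStable F) (h' : IsStable F') :
    IsStable (F * F') :=
  .of_denom_dvd (RatFunc.denom_mul_dvd F F') fun z hz => by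
    rw [map_mul]
    exact mul_ne_zero (h z hz) (h' z hz)

theorem IsStable.add {F F' : RatFunc ℝ} (h : IsStable F) (h' : IsStable F') :
    IsStable (F + F') :=
  .of_denom_dvd (RatFunc.denom_add_dvd F F') fun z hz => by
    rw [map_mul]
    exact mul_ne_zero (h z hz) (h' z hz)

/-- The ring of proper stable transfer functions. -/
def stableRing : Subring (RatFunc ℝ) where
  carrier := {F | IsStable F}
  mul_mem' := IsStable.mul
  add_mem' := IsStable.add
  one_mem' := by simpa using isStable_algebraMap 1
  zero_mem' := by simpa using isStable_algebraMap 0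
  neg_mem' {F} h := by
    have := (isStable_algebraMap (-1)).mul h
    simpa using this

/-- The expansion of a stable transfer function in powers of `q⁻¹`. -/
noncomputable def impulseSeries (F : stableRing) : PowerSeries ℝ :=
  PowerSeries.mk (impulse F)

/-- The Laurent expansion of a stable transfer function is a power series, `0` not being a zero of
the denominator, and its coefficients are absolutely summable. -/
theorem exists_series_of_isStable {F : RatFunc ℝ} (hF : IsStable F) :
    ∃ A : PowerSeries ℝ, (A : LaurentSeries ℝ) = F ∧
      Summable fun k => ‖PowerSeries.coeff k A‖ := by
  have hd0 : F.denom.coeff 0 ≠ 0 := by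
    have := hF 0 (by simp)
    simpa [Polynomial.aeval_def, Polynomial.eval₂_at_zero] using this
  have hdu : (F.denom : PowerSeries ℝ) * (F.denom : PowerSeries ℝ)⁻¹ = 1 :=
    PowerSeries.mul_inv_cancel _ (by simpa using hd0)
  refine ⟨(F.num : PowerSeries ℝ) * (F.denom : PowerSeries ℝ)⁻¹, ?_,
    summable_norm_coeff_mul (summable_norm_coeff_polynomial _) ?_⟩
  · have hd : (((F.denom : PowerSeries ℝ)) : LaurentSeries ℝ) ≠ 0 := by
      intro h
      have := congrArg (fun A : PowerSeries ℝ => (A : LaurentSeries ℝ)) hdu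
      simp only [PowerSeries.coe_mul, h, zero_mul, PowerSeries.coe_one] at this
      exact zero_ne_one this
    have h1 : ((F.num : PowerSeries ℝ) : LaurentSeries ℝ) =
        (F : LaurentSeries ℝ) * ((F.denom : PowerSeries ℝ) : LaurentSeries ℝ) := by
      have hden : algebraMap (Polynomial ℝ) (RatFunc ℝ) F.denom ≠ 0 := by
        simpa using F.denom_ne_zero
      rw [RatFunc.coe_coe, RatFunc.coe_coe, ← map_mul]
      congr 1
      exact (div_eq_iff hden).1 F.num_div_denom
    rw [PowerSeries.coe_mul, h1, mul_assoc, ← PowerSeries.coe_mul, hdu, PowerSeries.coe_one,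
      mul_one]
  · obtain ⟨Q, hQ, hQs⟩ := exists_summable_inverse (F.denom.map (algebraMap ℝ ℂ)) fun z hz => by
      rw [Polynomial.eval_map_algebraMap]
      exact hF z hz
    have hQ' : PowerSeries.map (algebraMap ℝ ℂ) (F.denom : PowerSeries ℝ)⁻¹ = Q := by
      have h2 := congrArg (PowerSeries.map (algebraMap ℝ ℂ)) hdu
      rw [map_mul, map_one, ← Polynomial.polynomial_map_coe] at h2
      linear_combination Q * h2 -
        PowerSeries.map (algebraMap ℝ ℂ) (F.denom : PowerSeries ℝ)⁻¹ * hQ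
    refine hQs.congr fun k => ?_
    rw [← hQ', PowerSeries.coeff_map]
    simp

theorem coe_impulseSeries (F : stableRing) :
    (impulseSeries F : LaurentSeries ℝ) = ((F : RatFunc ℝ) : LaurentSeries ℝ) := by
  obtain ⟨A, hA, -⟩ := exists_series_of_isStable F.2
  rw [← hA]
  congr 1
  ext k
  rw [impulseSeries, PowerSeries.coeff_mk, impulse, ← hA, LaurentSeries.coeff_coe_powerSeries]

theorem summable_impulse (F : stableRing) : Summable fun k => ‖impulse F k‖ := by
  obtain ⟨A, hA, hs⟩ := exists_series_of_isStable F.2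
  refine hs.congr fun k => ?_
  rw [impulse, ← hA, LaurentSeries.coeff_coe_powerSeries]

/-- Expansion in powers of `q⁻¹` as a ring homomorphism. -/
noncomputable def impulseHom : stableRing →+* PowerSeries ℝ where
  toFun := impulseSeries
  map_one' := HahnSeries.ofPowerSeries_injective (by
    change (impulseSeries 1 : LaurentSeries ℝ) = ((1 : PowerSeries ℝ) : LaurentSeries ℝ)
    rw [coe_impulseSeries]; simp)
  map_zero' := HahnSeries.ofPowerSeries_injective (by
    change (impulseSeries 0 : LaurentSeries ℝ) = ((0 : PowerSeries ℝ) : LaurentSeries ℝ)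
    rw [coe_impulseSeries]; simp)
  map_mul' F F' := HahnSeries.ofPowerSeries_injective (by
    change (impulseSeries (F * F') : LaurentSeries ℝ)
      = ((impulseSeries F * impulseSeries F' : PowerSeries ℝ) : LaurentSeries ℝ)
    rw [PowerSeries.coe_mul]
    simp only [coe_impulseSeries]
    simp)
  map_add' F F' := HahnSeries.ofPowerSeries_injective (by
    change (impulseSeries (F + F') : LaurentSeries ℝ)
      = ((impulseSeries F + impulseSeries F' : PowerSeries ℝ) : LaurentSeries ℝ)
    rw [PowerSeries.coe_add]
    simp only [coe_impulseSeries]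
    simp)

theorem coeff_impulseHom (F : stableRing) (k : ℕ) :
    PowerSeries.coeff k (impulseHom F) = impulse F k := by
  change PowerSeries.coeff k (PowerSeries.mk (impulse F)) = _
  rw [PowerSeries.coeff_mk]

/-- A polynomial in `q⁻¹`, as a stable transfer function. -/
noncomputable def polyStable : Polynomial ℝ →+* stableRing :=
  (algebraMap (Polynomial ℝ) (RatFunc ℝ)).codRestrict stableRing isStable_algebraMap

theorem impulse_polyStable (p : Polynomial ℝ) (k : ℕ) : impulse (polyStable p) k = p.coeff k := by
  have h : ((p : PowerSeries ℝ) : LaurentSeries ℝ) =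
    ((polyStable p : RatFunc ℝ) : LaurentSeries ℝ) := RatFunc.coe_coe p
  rw [impulse, ← h, LaurentSeries.coeff_coe_powerSeries, Polynomial.coeff_coe]

theorem polyStable_injective : Function.Injective polyStable := fun _ _ h =>
  RatFunc.algebraMap_injective ℝ (congrArg Subtype.val h)

/-- Finitely many transfer functions have a common denominator. -/
theorem exists_common_denominator {ι : Type*} [Fintype ι] (F : ι → stableRing) :
    ∃ d : Polynomial ℝ, d ≠ 0 ∧ ∀ k, ∃ q, polyStable d * F k = polyStable q := by
  classical
  -- The product of all denominators serves.
  refine ⟨∏ k, (F k : RatFunc ℝ).denom,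
    Finset.prod_ne_zero_iff.2 fun k _ => RatFunc.denom_ne_zero _, fun k =>
    ⟨(∏ l ∈ Finset.univ.erase k, (F l : RatFunc ℝ).denom) * (F k : RatFunc ℝ).num,
      Subtype.ext ?_⟩⟩
  have hden : algebraMap (Polynomial ℝ) (RatFunc ℝ) (F k : RatFunc ℝ).denom ≠ 0 := by
    simpa using RatFunc.denom_ne_zero (F k : RatFunc ℝ)
  have h1 := (div_eq_iff hden).1 (RatFunc.num_div_denom (F k : RatFunc ℝ))
  change algebraMap (Polynomial ℝ) (RatFunc ℝ) _ * (F k : RatFunc ℝ) =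
    algebraMap (Polynomial ℝ) (RatFunc ℝ) _
  rw [← Finset.mul_prod_erase _ _ (Finset.mem_univ k), map_mul, map_mul, h1]
  ring

/-! ### Bounded signals in a Hilbert space and the action of stable filters -/

/-- Substitution of a power-bounded element of a Banach algebra for `q⁻¹`. -/
noncomputable def impulseCalculus {A : Type*} [NormedRing A] [NormedAlgebra ℝ A] [CompleteSpace A]
    (S : A) (hS : ∀ k : ℕ, ‖S ^ k‖ ≤ 1) : stableRing →+* A :=
  have hs : ∀ F : stableRing, Summable fun k : ℕ => ‖impulse F k • S ^ k‖ := fun F =>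
    (summable_impulse F).of_nonneg_of_le (fun k => norm_nonneg (impulse F k • S ^ k)) fun k => by
      rw [norm_smul]
      exact mul_le_of_le_one_right (norm_nonneg _) (hS k)
  { toFun := fun F => ∑' k : ℕ, impulse F k • S ^ k
    map_one' := by
      have h : ∀ k : ℕ, impulse ((1 : stableRing) : RatFunc ℝ) k = if k = 0 then 1 else 0 := by
        intro k
        rw [← coeff_impulseHom, map_one, PowerSeries.coeff_one]
      rw [tsum_eq_single 0 fun k hk => by rw [h, if_neg hk, zero_smul], h, if_pos rfl, one_smul,
        pow_zero]
    map_zero' := by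
      have h : ∀ k : ℕ, impulse ((0 : stableRing) : RatFunc ℝ) k = 0 := by
        intro k
        rw [← coeff_impulseHom, map_zero, map_zero]
      refine (tsum_congr fun k => ?_).trans tsum_zero
      rw [h, zero_smul]
    map_add' := fun F F' => by
      rw [← (hs F).of_norm.tsum_add (hs F').of_norm]
      refine tsum_congr fun k => ?_
      rw [← add_smul, ← coeff_impulseHom, ← coeff_impulseHom, ← coeff_impulseHom, map_add, map_add]
    map_mul' := fun F F' => by
      rw [tsum_mul_tsum_eq_tsum_sum_antidiagonal_of_summable_norm (hs F) (hs F')]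
      refine tsum_congr fun k => ?_
      rw [← coeff_impulseHom, map_mul, PowerSeries.coeff_mul, Finset.sum_smul]
      refine Finset.sum_congr rfl fun ab hab => ?_
      rw [Finset.HasAntidiagonal.mem_antidiagonal] at hab
      rw [smul_mul_smul_comm, ← pow_add, hab, coeff_impulseHom, coeff_impulseHom] }

theorem hasSum_impulseCalculus {A : Type*} [NormedRing A] [NormedAlgebra ℝ A] [CompleteSpace A]
    (S : A) (hS : ∀ k : ℕ, ‖S ^ k‖ ≤ 1) (F : stableRing) :
    HasSum (fun k : ℕ => impulse F k • S ^ k) (impulseCalculus S hS F) :=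
  Summable.hasSum <| ((summable_impulse F).of_nonneg_of_le
    (fun k => norm_nonneg (impulse F k • S ^ k)) fun k => by
      rw [norm_smul]
      exact mul_le_of_le_one_right (norm_nonneg _) (hS k)).of_norm

/-- Bounded two-sided sequences in `E`. With `E = L²(P)` these are the scalar signals with bounded
second moments, equal signals being almost surely equal at each time. -/
abbrev Sig (E : Type*) [NormedAddCommGroup E] := BoundedContinuousFunction ℤ E

section SignalSpace

variable {E : Type*} [NormedAddCommGroup E] [InnerProductSpace ℝ E]

/-- The delay by `n` steps, `(q⁻ⁿ s)(t) = s(t - n)`, for `n` of either sign. -/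
noncomputable def shift (n : ℤ) : Sig E →L[ℝ] Sig E :=
  LinearMap.mkContinuous
    { toFun := fun s => s.compContinuous ⟨fun t => t - n, continuous_of_discreteTopology⟩
      map_add' := fun _ _ => rfl
      map_smul' := fun _ _ => rfl } 1 fun s => by
    rw [one_mul]
    exact (BoundedContinuousFunction.norm_le (norm_nonneg s)).2 fun t => s.norm_coe_le_norm _

@[simp] theorem shift_apply (n : ℤ) (s : Sig E) (t : ℤ) : shift n s t = s (t - n) := rfl

theorem norm_shift_le (n : ℤ) : ‖(shift n : Sig E →L[ℝ] Sig E)‖ ≤ 1 :=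
  LinearMap.mkContinuous_norm_le _ zero_le_one _

theorem shift_shift (m n : ℤ) (s : Sig E) : shift m (shift n s) = shift (m + n) s := by
  ext t
  simp only [shift_apply]
  congr 1
  ring

@[simp] theorem shift_zero (s : Sig E) : shift 0 s = s := by
  ext t
  simp

theorem shift_mul (m n : ℤ) :
    (shift m * shift n : Sig E →L[ℝ] Sig E) = shift (m + n) := by
  ext1 s
  exact shift_shift m n s

theorem shift_pow (k : ℕ) : (shift 1 : Sig E →L[ℝ] Sig E) ^ k = shift k := by
  induction k with
  | zero =>
    ext1 s
    simp
  | succ k ih =>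
    rw [pow_succ, ih, shift_mul]
    norm_cast

theorem norm_shift_pow_le (k : ℕ) : ‖(shift 1 : Sig E →L[ℝ] Sig E) ^ k‖ ≤ 1 := by
  rw [shift_pow]
  exact norm_shift_le _

section Action

variable [CompleteSpace E]

/-- Stable transfer functions act on bounded signals by `F ↦ ∑ g(k) q⁻ᵏ`; the series converges in
operator norm because the impulse response is absolutely summable. -/
noncomputable def filterHom : stableRing →+* (Sig E →L[ℝ] Sig E) :=
  impulseCalculus (shift 1 : Sig E →L[ℝ] Sig E) norm_shift_pow_le

noncomputable instance : Module stableRing (Sig E) := 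
  Module.compHom (Sig E) (filterHom (E := E))

theorem hasSum_stable_smul (F : stableRing) (s : Sig E) :
    HasSum (fun k : ℕ => impulse F k • shift (k : ℤ) s) (F • s) := by
  have h := (hasSum_impulseCalculus (shift 1 : Sig E →L[ℝ] Sig E) norm_shift_pow_le F).mapL
    (ContinuousLinearMap.apply ℝ (Sig E) s)
  simp only [shift_pow] at h
  exact h

theorem polyStable_smul (p : Polynomial ℝ) (s : Sig E) :
    polyStable p • s = ∑ k ∈ p.support, p.coeff k • shift (k : ℤ) s := by
  refine (hasSum_stable_smul _ s).unique ?_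
  simp only [impulse_polyStable]
  refine hasSum_sum_of_ne_finset_zero fun k hk => ?_
  rw [Polynomial.notMem_support_iff.1 hk, zero_smul]

/-- A closed set of signals that contains all delays of `s` contains every filtered version of
`s`. -/
theorem stable_smul_mem {M : Submodule ℝ (Sig E)} (hM : IsClosed (M : Set (Sig E))) {s : Sig E}
    (hs : ∀ k : ℕ, shift (k : ℤ) s ∈ M) (F : stableRing) : F • s ∈ M :=
  hM.mem_of_tendsto (hasSum_stable_smul F s) <| Eventually.of_forall fun _ =>
    M.sum_mem fun k _ => M.smul_mem _ (hs k)

/-- For a strictly proper filter only the strict delays matter. -/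
theorem stable_smul_mem_of_impulse_zero {M : Submodule ℝ (Sig E)}
    (hM : IsClosed (M : Set (Sig E))) {s : Sig E}
    (hs : ∀ k : ℕ, k ≠ 0 → shift (k : ℤ) s ∈ M) {F : stableRing} (hF : impulse F 0 = 0) :
    F • s ∈ M := by
  refine hM.mem_of_tendsto (hasSum_stable_smul F s) <| Eventually.of_forall fun _ =>
    M.sum_mem fun k _ => ?_
  by_cases hk : k = 0
  · rw [hk, hF, zero_smul]
    exact M.zero_mem
  · exact M.smul_mem _ (hs k hk)

theorem shift_stable_smul (n : ℤ) (F : stableRing) (s : Sig E) :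
    shift n (F • s) = F • shift n s := by
  refine ((hasSum_stable_smul F s).mapL (shift n)).unique ?_
  convert hasSum_stable_smul F (shift n s) using 2 with k
  rw [map_smul, shift_shift, shift_shift, add_comm]

end Action

/-! ### Time-averaged inner products -/

/-- `(1/N) ∑_{t=1}^N ⟪s(t), w(t)⟫`. -/
noncomputable def meanInner (N : ℕ) (s w : Sig E) : ℝ :=
  (N : ℝ)⁻¹ * ∑ t ∈ Finset.Icc 1 N, inner ℝ (s (t : ℤ)) (w (t : ℤ))

theorem meanInner_comm (N : ℕ) (s w : Sig E) : meanInner N s w = meanInner N w s := by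
  simp only [meanInner, real_inner_comm]

theorem meanInner_add_right (N : ℕ) (s w w' : Sig E) :
    meanInner N s (w + w') = meanInner N s w + meanInner N s w' := by
  simp [meanInner, inner_add_right, Finset.sum_add_distrib, mul_add]

theorem meanInner_smul_right (N : ℕ) (c : ℝ) (s w : Sig E) :
    meanInner N s (c • w) = c * meanInner N s w := by
  simp only [meanInner, BoundedContinuousFunction.coe_smul, real_inner_smul_right,
    ← Finset.mul_sum]
  ring

theorem meanInner_sub_right (N : ℕ) (s w w' : Sig E) :
    meanInner N s (w - w') = meanInner N s w - meanInner N s w' := by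
  simp [meanInner, inner_sub_right, Finset.sum_sub_distrib, mul_sub]

theorem meanInner_self_nonneg (N : ℕ) (s : Sig E) : 0 ≤ meanInner N s s :=
  mul_nonneg (by positivity) (Finset.sum_nonneg fun _ _ => real_inner_self_nonneg)

theorem abs_meanInner_le (N : ℕ) (s w : Sig E) : |meanInner N s w| ≤ ‖s‖ * ‖w‖ := by
  rcases Nat.eq_zero_or_pos N with rfl | hN
  · simp only [meanInner, CharP.cast_eq_zero, inv_zero, zero_mul, abs_zero]
    positivity
  have hN' : (0 : ℝ) < N := by exact_mod_cast hN
  rw [meanInner, abs_mul, abs_of_pos (inv_pos.2 hN'), inv_mul_le_iff₀ hN']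
  refine (Finset.abs_sum_le_sum_abs _ _).trans ?_
  refine (Finset.sum_le_card_nsmul _ _ (‖s‖ * ‖w‖) fun t _ => ?_).trans (by simp)
  exact (abs_real_inner_le_norm _ _).trans
    (mul_le_mul (s.norm_coe_le_norm _) (w.norm_coe_le_norm _) (norm_nonneg _) (norm_nonneg _))

/-- A common delay of both signals changes the average only by boundary terms. -/
theorem tendsto_meanInner_shift_sub (n : ℤ) (s w : Sig E) :
    Tendsto (fun N => meanInner N (shift n s) (shift n w) - meanInner N s w) atTop (𝓝 0) := by
  have one : ∀ s w : Sig E, Tendsto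
      (fun N => meanInner N (shift 1 s) (shift 1 w) - meanInner N s w) atTop (𝓝 0) := by
    intro s w
    have h : ∀ N, meanInner N (shift 1 s) (shift 1 w) - meanInner N s w =
        (N : ℝ)⁻¹ * (inner ℝ (s 0) (w 0) - inner ℝ (s N) (w N)) := by
      intro N
      rw [meanInner, meanInner, ← mul_sub, ← Finset.sum_sub_distrib]
      congr 1
      induction N with
      | zero => simp
      | succ N ih =>
        rw [Finset.sum_Icc_succ_top (by omega), ih]
        simp
    simp only [h]
    -- The sums telescope, leaving the times `0` and `N`.
    refine squeeze_zero_norm (a := fun N : ℕ => (N : ℝ)⁻¹ * (2 * (‖s‖ * ‖w‖))) (fun N => ?_) ?_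
    · have hb : ∀ t : ℤ, |inner ℝ (s t) (w t)| ≤ ‖s‖ * ‖w‖ := fun t =>
        (abs_real_inner_le_norm _ _).trans
          (mul_le_mul (s.norm_coe_le_norm _) (w.norm_coe_le_norm _) (norm_nonneg _)
            (norm_nonneg _))
      rw [norm_mul, Real.norm_of_nonneg (by positivity)]
      refine mul_le_mul_of_nonneg_left ?_ (by positivity)
      refine (norm_sub_le _ _).trans ?_
      have h0 := hb 0
      have hN := hb N
      rw [Real.norm_eq_abs, Real.norm_eq_abs]
      linarith
    · simpa using tendsto_inv_atTop_nhds_zero_nat (𝕜 := ℝ).mul_const (2 * (‖s‖ * ‖w‖))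
  induction n using Int.induction_on generalizing s w with
  | zero => simp
  | succ n ih =>
    have := (one (shift n s) (shift n w)).add (ih s w)
    simp only [shift_shift, add_zero, sub_add_sub_cancel] at this
    rwa [add_comm]
  | pred n ih =>
    have := (ih s w).sub (one (shift (-n - 1) s) (shift (-n - 1) w))
    simp only [shift_shift, add_sub_cancel, sub_zero] at this
    refine this.congr fun N => ?_
    ring

theorem tendsto_meanInner_shift {s w : Sig E} {r : ℝ} {m n : ℤ}
    (h : Tendsto (fun N => meanInner N s (shift (n - m) w)) atTop (𝓝 r)) :
    Tendsto (fun N => meanInner N (shift m s) (shift n w)) atTop (𝓝 r) := by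
  have h1 := (tendsto_meanInner_shift_sub m s (shift (n - m) w)).add h
  simpa only [shift_shift, add_sub_cancel, sub_add_cancel, zero_add] using h1

/-- The signals whose averaged inner product with `s` converges. -/
noncomputable def convergentWith (s : Sig E) : Submodule ℝ (Sig E) where
  carrier := {w | ∃ r, Tendsto (fun N => meanInner N s w) atTop (𝓝 r)}
  add_mem' := by
    rintro w w' ⟨r, hr⟩ ⟨r', hr'⟩
    exact ⟨r + r', by simpa only [meanInner_add_right] using hr.add hr'⟩
  zero_mem' := ⟨0, by simp [meanInner]⟩
  smul_mem' := by
    rintro c w ⟨r, hr⟩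
    exact ⟨c * r, by simpa only [meanInner_smul_right] using hr.const_mul c⟩

theorem mem_convergentWith_comm {s w : Sig E} : w ∈ convergentWith s ↔ s ∈ convergentWith w := by
  change (∃ r, Tendsto (fun N => meanInner N s w) atTop (𝓝 r)) ↔
    ∃ r, Tendsto (fun N => meanInner N w s) atTop (𝓝 r)
  simp only [fun N => meanInner_comm N s w]

theorem isClosed_convergentWith (s : Sig E) :
    IsClosed (convergentWith s : Set (Sig E)) := by
  refine isClosed_of_closure_subset fun w hw => ?_
  refine cauchySeq_tendsto_of_complete (Metric.cauchySeq_iff.2 fun ε hε => ?_)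
  obtain ⟨w', ⟨r, hr⟩, hww'⟩ := Metric.mem_closure_iff.1 hw (ε / (3 * (‖s‖ + 1))) (by positivity)
  have hclose : ∀ N, |meanInner N s w - meanInner N s w'| < ε / 3 := by
    intro N
    rw [← meanInner_sub_right]
    refine (abs_meanInner_le _ _ _).trans_lt ?_
    rw [dist_eq_norm, lt_div_iff₀ (by positivity)] at hww'
    nlinarith [norm_nonneg s, norm_nonneg (w - w')]
  obtain ⟨N₀, hN₀⟩ := Metric.cauchySeq_iff.1 hr.cauchySeq (ε / 3) (by positivity)
  refine ⟨N₀, fun m hm n hn => ?_⟩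
  have h1 := hclose m
  have h2 := hclose n
  have h3 := hN₀ m hm n hn
  rw [Real.dist_eq] at h3 ⊢
  rw [abs_lt] at *
  constructor <;> linarith [h1.1, h1.2, h2.1, h2.2, h3.1, h3.2]

/-! ### The mean-power inner product -/

theorem exists_tendsto_meanInner (s w : Sig E) :
    ∃ r, Tendsto (fun N => meanInner N s w) (hyperfilter ℕ) (𝓝 r) := by
  obtain ⟨r, -, hr⟩ := isCompact_Icc.ultrafilter_le_nhds
    ((hyperfilter ℕ).map fun N => meanInner N s w)
    (show _ ≤ 𝓟 (Set.Icc (-(‖s‖ * ‖w‖)) (‖s‖ * ‖w‖)) from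
      le_principal_iff.2 (Eventually.of_forall (f := (hyperfilter ℕ : Filter ℕ)) fun N =>
        abs_le.1 (abs_meanInner_le N s w)))
  exact ⟨r, hr⟩

theorem tendsto_limUnder_meanInner (s w : Sig E) :
    Tendsto (fun N => meanInner N s w) (hyperfilter ℕ)
      (𝓝 (limUnder (hyperfilter ℕ : Filter ℕ) fun N => meanInner N s w)) :=
  tendsto_nhds_limUnder (exists_tendsto_meanInner s w)

/-- The limit of the averaged inner products along a fixed nonprincipal ultrafilter. It exists for
every pair of bounded signals, is a shift-invariant positive semidefinite bilinear form, and agrees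
with the generalized expectation whenever the latter exists. -/
noncomputable def powerInner : Sig E →L[ℝ] Sig E →L[ℝ] ℝ :=
  LinearMap.mkContinuous₂
    (LinearMap.mk₂ ℝ (fun s w => limUnder (hyperfilter ℕ : Filter ℕ) fun N => meanInner N s w)
      (fun s s' w => tendsto_nhds_unique (tendsto_limUnder_meanInner _ _) <| by
        have := (tendsto_limUnder_meanInner s w).add (tendsto_limUnder_meanInner s' w)
        refine this.congr fun N => ?_
        rw [meanInner_comm N (s + s'), meanInner_add_right, meanInner_comm N s,
          meanInner_comm N s'])
      (fun c s w => tendsto_nhds_unique (tendsto_limUnder_meanInner _ _) <| by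
        refine ((tendsto_limUnder_meanInner s w).const_mul c).congr fun N => ?_
        rw [meanInner_comm N (c • s), meanInner_smul_right, meanInner_comm N s])
      (fun s w w' => tendsto_nhds_unique (tendsto_limUnder_meanInner _ _) <| by
        simpa only [meanInner_add_right] using
          (tendsto_limUnder_meanInner s w).add (tendsto_limUnder_meanInner s w'))
      (fun c s w => tendsto_nhds_unique (tendsto_limUnder_meanInner _ _) <| by
        refine ((tendsto_limUnder_meanInner s w).const_mul c).congr fun N => ?_
        rw [meanInner_smul_right]))
    1 fun s w => by
      rw [one_mul]
      exact le_of_tendsto (tendsto_limUnder_meanInner s w).norm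
        (Eventually.of_forall fun N => abs_meanInner_le N s w)

theorem tendsto_powerInner (s w : Sig E) :
    Tendsto (fun N => meanInner N s w) (hyperfilter ℕ) (𝓝 (powerInner s w)) :=
  tendsto_limUnder_meanInner s w

theorem powerInner_eq_of_tendsto {s w : Sig E} {r : ℝ}
    (h : Tendsto (fun N => meanInner N s w) atTop (𝓝 r)) : powerInner s w = r :=
  tendsto_nhds_unique (tendsto_powerInner s w) (h.mono_left Nat.hyperfilter_le_atTop)

theorem tendsto_of_mem_convergentWith {s w : Sig E} (h : w ∈ convergentWith s) :
    Tendsto (fun N => meanInner N s w) atTop (𝓝 (powerInner s w)) := by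
  obtain ⟨r, hr⟩ := h
  rwa [powerInner_eq_of_tendsto hr]

theorem powerInner_comm (s w : Sig E) : powerInner s w = powerInner w s :=
  tendsto_nhds_unique (tendsto_powerInner s w) <| by
    simpa only [fun N => meanInner_comm N s w] using tendsto_powerInner w s

theorem powerInner_self_nonneg (s : Sig E) : 0 ≤ powerInner s s :=
  ge_of_tendsto (tendsto_powerInner s s) (Eventually.of_forall fun N => meanInner_self_nonneg N s)

theorem powerInner_shift_shift (n : ℤ) (s w : Sig E) :
    powerInner (shift n s) (shift n w) = powerInner s w := by
  have h := ((tendsto_powerInner (shift n s) (shift n w)).sub (tendsto_powerInner s w))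
  have h0 := tendsto_nhds_unique h
    ((tendsto_meanInner_shift_sub n s w).mono_left Nat.hyperfilter_le_atTop)
  exact sub_eq_zero.1 h0

theorem powerInner_shift_left (n : ℤ) (s w : Sig E) :
    powerInner (shift n s) w = powerInner s (shift (-n) w) := by
  rw [← powerInner_shift_shift n s, shift_shift, add_neg_cancel, shift_zero]

theorem powerInner_sq_le (s w : Sig E) :
    powerInner s w ^ 2 ≤ powerInner s s * powerInner w w := by
  have h : ∀ c : ℝ, 0 ≤ powerInner w w * (c * c) + 2 * powerInner s w * c + powerInner s s := by
    intro c
    have := powerInner_self_nonneg (s + c • w)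
    simp only [map_add, map_smul, add_apply, smul_apply,
      smul_eq_mul, powerInner_comm w s] at this
    linarith
  have := discrim_le_zero h
  rw [discrim] at this
  linarith

theorem powerInner_add_self_of_eq_zero {s w : Sig E} (h : powerInner s w = 0) :
    powerInner (s + w) (s + w) = powerInner s s + powerInner w w := by
  simp only [map_add, add_apply, h, powerInner_comm w s]
  ring

/-- The signals of zero mean power. -/
def IsNull (s : Sig E) : Prop := powerInner s s = 0

theorem IsNull.powerInner_eq_zero {s : Sig E} (h : IsNull s) (w : Sig E) : powerInner w s = 0 := by
  have := powerInner_sq_le w s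
  rw [show powerInner s s = 0 from h, mul_zero] at this
  exact pow_eq_zero_iff two_ne_zero |>.1 (le_antisymm this (sq_nonneg _))

/-- The signals uncorrelated at every lag with all signals of the set `Z`. -/
noncomputable def orthSig (Z : Set (Sig E)) : Submodule ℝ (Sig E) where
  carrier := {w | ∀ z ∈ Z, ∀ n : ℤ, powerInner (shift n z) w = 0}
  add_mem' {w w'} h h' z hz n := by rw [map_add, h z hz n, h' z hz n, add_zero]
  zero_mem' z _ n := map_zero _
  smul_mem' c w h z hz n := by rw [map_smul, h z hz n, smul_zero]

theorem isClosed_orthSig (Z : Set (Sig E)) : IsClosed (orthSig Z : Set (Sig E)) := by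
  have : (orthSig Z : Set (Sig E)) =
      ⋂ z ∈ Z, ⋂ n : ℤ, {w | powerInner (shift n z) w = 0} := by
    ext w
    simp [orthSig]
  rw [this]
  exact isClosed_biInter fun z _ => isClosed_iInter fun n =>
    isClosed_eq (powerInner (shift n z)).continuous continuous_const

theorem shift_mem_orthSig {Z : Set (Sig E)} {w : Sig E} (hw : w ∈ orthSig Z) (m : ℤ) :
    shift m w ∈ orthSig Z := by
  intro z hz n
  rw [powerInner_comm, powerInner_shift_left, powerInner_comm, shift_shift]
  exact hw z hz _

theorem mem_orthSig_of_isNull {Z : Set (Sig E)} {w : Sig E} (hw : IsNull w) : w ∈ orthSig Z :=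
  fun _ _ _ => hw.powerInner_eq_zero _

theorem isNull_iff_mem_orthSig_univ {s : Sig E} : IsNull s ↔ s ∈ orthSig (Set.univ : Set (Sig E)) :=
  ⟨mem_orthSig_of_isNull, fun h => by
    have h0 := h s trivial 0
    rwa [shift_zero] at h0⟩

theorem mem_orthSig_orthSig {Z : Set (Sig E)} {z : Sig E} (hz : z ∈ Z) :
    z ∈ orthSig (orthSig Z : Set (Sig E)) := by
  intro w hw n
  rw [powerInner_shift_left, powerInner_comm]
  exact hw z hz _

theorem isNull_of_mem_orthSig {Z : Set (Sig E)} {s : Sig E} (h : s ∈ orthSig Z)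
    (h' : s ∈ orthSig (orthSig Z : Set (Sig E))) : IsNull s := by
  have h0 := h' s h 0
  rwa [shift_zero] at h0

/-- The double orthogonal complement contains the limits, in mean power, of its members. -/
theorem mem_orthSig_orthSig_of_approx {Z : Set (Sig E)} {s : Sig E}
    (h : ∀ δ : ℝ, 0 < δ → ∃ c ∈ orthSig (orthSig Z : Set (Sig E)),
      powerInner (s - c) (s - c) ≤ δ) :
    s ∈ orthSig (orthSig Z : Set (Sig E)) := by
  intro w hw n
  set w' := shift n w
  by_contra hne
  have hpos : 0 < powerInner w' s ^ 2 := by positivity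
  have hw0 : 0 ≤ powerInner w' w' := powerInner_self_nonneg _
  obtain ⟨c, hc, hcδ⟩ := h (powerInner w' s ^ 2 / (powerInner w' w' + 1)) (by positivity)
  have h1 : powerInner w' (s - c) = powerInner w' s := by
    rw [map_sub, hc w hw n, sub_zero]
  have h2 := powerInner_sq_le w' (s - c)
  rw [h1] at h2
  rw [le_div_iff₀ (by positivity)] at hcδ
  have h3 : powerInner (s - c) (s - c) ≤ 0 := by linarith
  have h4 := powerInner_self_nonneg (s - c)
  rw [le_antisymm h3 h4, mul_zero] at h2
  linarith

variable [CompleteSpace E]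

/-- The orthogonal complement as a module over the ring of stable filters. -/
noncomputable def orthFilterModule (Z : Set (Sig E)) : Submodule stableRing (Sig E) where
  carrier := orthSig Z
  add_mem' := (orthSig Z).add_mem
  zero_mem' := (orthSig Z).zero_mem
  smul_mem' F _ hw := stable_smul_mem (isClosed_orthSig Z) (fun k => shift_mem_orthSig hw k) F

end SignalSpace

/-! ### Matrices of stable filters -/

section MatrixAction

variable {E : Type*} [NormedAddCommGroup E] [InnerProductSpace ℝ E] [CompleteSpace E]
variable {α β γ : Type*} [Fintype β] [Fintype γ]

/-- The filtered vector signal `A(q) s`. -/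
noncomputable def matFilter (A : Matrix α β stableRing) (s : β → Sig E) : α → Sig E :=
  fun a => ∑ b, A a b • s b

theorem matFilter_mul (A : Matrix α β stableRing) (B : Matrix β γ stableRing) (s : γ → Sig E) :
    matFilter (A * B) s = matFilter A (matFilter B s) := by
  funext a
  simp only [matFilter, Matrix.mul_apply, Finset.sum_smul, Finset.smul_sum, mul_smul]
  exact Finset.sum_comm

theorem matFilter_sub (A B : Matrix α β stableRing) (s : β → Sig E) :
    matFilter (A - B) s = matFilter A s - matFilter B s := by
  funext a
  simp [matFilter, sub_smul, Finset.sum_sub_distrib]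

theorem matFilter_add_right (A : Matrix α β stableRing) (s w : β → Sig E) :
    matFilter A (s + w) = matFilter A s + matFilter A w := by
  funext a
  simp [matFilter, smul_add, Finset.sum_add_distrib]

theorem matFilter_sub_right (A : Matrix α β stableRing) (s w : β → Sig E) :
    matFilter A (s - w) = matFilter A s - matFilter A w := by
  funext a
  simp [matFilter, smul_sub, Finset.sum_sub_distrib]

theorem matFilter_one [DecidableEq β] (s : β → Sig E) :
    matFilter (1 : Matrix β β stableRing) s = s := by
  funext a
  simp [matFilter, Matrix.one_apply, ite_smul]

theorem matFilter_mem {M : Submodule stableRing (Sig E)} (A : Matrix α β stableRing)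
    {s : β → Sig E} (hs : ∀ b, s b ∈ M) (a : α) : matFilter A s a ∈ M :=
  M.sum_mem fun b _ => M.smul_mem _ (hs b)

end MatrixAction

theorem IsStableMatrix.exists_lift {α β : Type*} {F : Matrix α β (RatFunc ℝ)}
    (hF : IsStableMatrix F) : ∃ A : Matrix α β stableRing, A.map Subtype.val = F :=
  ⟨fun a b => ⟨F a b, hF a b⟩, rfl⟩

theorem map_val_injective {α β : Type*} :
    Function.Injective fun A : Matrix α β stableRing => A.map Subtype.val :=
  Matrix.map_injective Subtype.val_injective

theorem map_val_mul {α β γ : Type*} [Fintype β] (A : Matrix α β stableRing)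
    (B : Matrix β γ stableRing) :
    (A * B).map Subtype.val = A.map Subtype.val * B.map Subtype.val :=
  Matrix.map_mul (f := stableRing.subtype)

theorem map_val_one {β : Type*} [DecidableEq β] :
    (1 : Matrix β β stableRing).map Subtype.val = 1 :=
  Matrix.map_one stableRing.subtype (map_zero _) (map_one _)

theorem map_val_sub {α β : Type*} (A B : Matrix α β stableRing) :
    (A - B).map Subtype.val = A.map Subtype.val - B.map Subtype.val :=
  Matrix.map_sub (stableRing.subtype) (map_sub stableRing.subtype) A B

/-- The direct feedthrough term `g(0)`. -/
noncomputable def feedthrough : stableRing →+* ℝ :=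
  (PowerSeries.constantCoeff (R := ℝ)).comp impulseHom

theorem feedthrough_apply (F : stableRing) : feedthrough F = impulse F 0 := by
  rw [← coeff_impulseHom, PowerSeries.coeff_zero_eq_constantCoeff_apply]
  rfl

/-- A noise model lifts to an invertible matrix over the ring of stable filters whose feedthrough
is the identity; monicity makes the determinant nonzero, so that the matrix inverse in the
definition of a noise model is a genuine one. -/
theorem IsNoiseModel.exists_lift {β : Type*} [Fintype β] [DecidableEq β]
    {H : Matrix β β (RatFunc ℝ)} (hH : IsNoiseModel H) :
    ∃ A B : Matrix β β stableRing, A.map Subtype.val = H ∧ B.map Subtype.val = H⁻¹ ∧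
      A * B = 1 ∧ B * A = 1 ∧ A.map feedthrough = 1 ∧ B.map feedthrough = 1 := by
  obtain ⟨A, hA⟩ := hH.stable.exists_lift
  obtain ⟨B, hB⟩ := hH.stable_inv.exists_lift
  have hA1 : A.map feedthrough = 1 := by
    ext a b
    rw [Matrix.map_apply, feedthrough_apply, ← hH.monic a b, ← hA]
    rfl
  have hdet : H.det ≠ 0 := by
    intro h0
    have h1 : stableRing.subtype A.det = 0 := by
      rw [RingHom.map_det, ← h0, ← hA]
      rfl
    have h2 : A.det = 0 := Subtype.ext h1
    have h3 := congrArg feedthrough h2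
    rw [RingHom.map_det, map_zero, RingHom.mapMatrix_apply, hA1, Matrix.det_one] at h3
    exact one_ne_zero h3
  have hAB : A * B = 1 := by
    apply map_val_injective
    change (A * B).map Subtype.val = (1 : Matrix β β stableRing).map Subtype.val
    rw [map_val_mul, map_val_one, hA, hB, Matrix.mul_nonsing_inv _ (isUnit_iff_ne_zero.2 hdet)]
  refine ⟨A, B, hA, hB, hAB, mul_eq_one_comm.1 hAB, hA1, ?_⟩
  have h := congrArg (feedthrough.mapMatrix) hAB
  rw [map_mul, map_one, RingHom.mapMatrix_apply, hA1, one_mul] at h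
  exact h

/-! ### Random signals as bounded signals in `L²` -/

section Representation

variable {Ω : Type*} [MeasurableSpace Ω] {P : Measure Ω}

/-- The scalar random signal `s` is almost surely equal to `σ` at each time. -/
def Represents (P : Measure Ω) (s : ℤ → Ω → ℝ) (σ : Sig (Lp ℝ 2 P)) : Prop :=
  ∀ t, s t =ᵐ[P] σ t

theorem exists_represents {s : ℤ → Ω → ℝ} (hs : ∀ t, MemLp (s t) 2 P) {C : ℝ}
    (hC : ∀ t, ∫ ω, s t ω ^ 2 ∂P ≤ C) : ∃ σ, Represents P s σ := by
  refine ⟨BoundedContinuousFunction.ofNormedAddCommGroupDiscrete (fun t => (hs t).toLp (s t))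
    (Real.sqrt C) fun t => ?_, fun t => (hs t).coeFn_toLp.symm⟩
  refine Real.le_sqrt_of_sq_le ((le_of_eq ?_).trans (hC t))
  rw [← real_inner_self_eq_norm_sq, L2.inner_def]
  refine integral_congr_ae ?_
  filter_upwards [(hs t).coeFn_toLp] with ω hω
  rw [hω]
  simp [sq]

theorem IsQuasiStationary.exists_represents {ι : Type*} {s : ℤ → Ω → ι → ℝ}
    (hs : IsQuasiStationary P s) :
    ∃ σ : ι → Sig (Lp ℝ 2 P), ∀ k, Represents P (fun t ω => s t ω k) (σ k) := by
  obtain ⟨C, hC⟩ := hs.bounded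
  choose σ hσ using fun k => _root_.exists_represents (fun t => hs.memLp t k) (fun t => hC t k)
  exact ⟨σ, hσ⟩

theorem Represents.unique {s s' : ℤ → Ω → ℝ} {σ σ' : Sig (Lp ℝ 2 P)} (h : Represents P s σ)
    (h' : Represents P s' σ') (hs : ∀ t, s t =ᵐ[P] s' t) : σ = σ' := by
  ext1 t
  exact Lp.ext ((h t).symm.trans ((hs t).trans (h' t)))

theorem Represents.congr {s s' : ℤ → Ω → ℝ} {σ : Sig (Lp ℝ 2 P)} (h : Represents P s σ)
    (hs : ∀ t, s' t =ᵐ[P] s t) : Represents P s' σ := fun t => (hs t).trans (h t)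

theorem Represents.add {s s' : ℤ → Ω → ℝ} {σ σ' : Sig (Lp ℝ 2 P)} (h : Represents P s σ)
    (h' : Represents P s' σ') : Represents P (fun t ω => s t ω + s' t ω) (σ + σ') := fun t => by
  filter_upwards [h t, h' t, Lp.coeFn_add (σ t) (σ' t)] with ω h1 h2 h3
  rw [h1, h2, BoundedContinuousFunction.add_apply, h3, Pi.add_apply]

theorem Represents.sub {s s' : ℤ → Ω → ℝ} {σ σ' : Sig (Lp ℝ 2 P)} (h : Represents P s σ)
    (h' : Represents P s' σ') : Represents P (fun t ω => s t ω - s' t ω) (σ - σ') := fun t => by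
  filter_upwards [h t, h' t, Lp.coeFn_sub (σ t) (σ' t)] with ω h1 h2 h3
  rw [h1, h2, BoundedContinuousFunction.sub_apply, h3, Pi.sub_apply]

theorem Represents.const_mul {s : ℤ → Ω → ℝ} {σ : Sig (Lp ℝ 2 P)} (c : ℝ) (h : Represents P s σ) :
    Represents P (fun t ω => c * s t ω) (c • σ) := fun t => by
  filter_upwards [h t, Lp.coeFn_smul c (σ t)] with ω h1 h2
  rw [h1, BoundedContinuousFunction.smul_apply, h2, Pi.smul_apply, smul_eq_mul]

theorem represents_zero : Represents P (fun _ _ => 0) (0 : Sig (Lp ℝ 2 P)) := fun _ =>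
  (Lp.coeFn_zero ℝ 2 P).symm

theorem Represents.sum {ι : Type*} (A : Finset ι) {s : ι → ℤ → Ω → ℝ} {σ : ι → Sig (Lp ℝ 2 P)}
    (h : ∀ k ∈ A, Represents P (s k) (σ k)) :
    Represents P (fun t ω => ∑ k ∈ A, s k t ω) (∑ k ∈ A, σ k) := by
  classical
  induction A using Finset.induction_on with
  | empty => simpa using represents_zero
  | insert k A hk ih =>
    simp only [Finset.sum_insert hk]
    exact (h k (Finset.mem_insert_self k A)).add
      (ih fun l hl => h l (Finset.mem_insert_of_mem hl))

theorem Represents.delay {s : ℤ → Ω → ℝ} {σ : Sig (Lp ℝ 2 P)} (h : Represents P s σ) (n : ℤ) :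
    Represents P (fun t => s (t - n)) (shift n σ) := fun t => h (t - n)

/-- The pathwise filter agrees almost surely with the filter that converges in `L²`. -/
theorem Represents.filter {s : ℤ → Ω → ℝ} {σ : Sig (Lp ℝ 2 P)} (h : Represents P s σ)
    (F : stableRing) :
    Represents P (fun t ω => ∑' k : ℕ, impulse F k * s (t - (k : ℤ)) ω) (F • σ) := by
  intro t
  have hsum : HasSum (fun k : ℕ => impulse F k • σ (t - k)) ((F • σ) t) :=
    (hasSum_stable_smul F σ).mapL (BoundedContinuousFunction.evalCLM ℝ t)
  have hnorm : Summable fun k : ℕ => ‖impulse F k • σ (t - k)‖ := by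
    refine ((summable_impulse F).mul_right ‖σ‖).of_nonneg_of_le (fun _ => norm_nonneg _)
      fun k => ?_
    rw [norm_smul]
    exact mul_le_mul_of_nonneg_left (σ.norm_coe_le_norm _) (norm_nonneg _)
  have hfin : ∑' k : ℕ, ‖impulse F k • σ (t - k)‖ₑ ≠ ⊤ :=
    tsum_enorm_ne_top_iff_summable_norm.2 hnorm
  have hs : ∀ᵐ ω ∂P, ∀ k : ℕ, s (t - k) ω = σ (t - k) ω := ae_all_iff.2 fun k => h (t - k)
  have hc : ∀ᵐ ω ∂P, ∀ k : ℕ, (impulse F k • σ (t - k) : Lp ℝ 2 P) ω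
      = impulse F k * σ (t - k) ω := ae_all_iff.2 fun k => by
    filter_upwards [Lp.coeFn_smul (impulse F k) (σ (t - k))] with ω h1
    rw [h1, Pi.smul_apply, smul_eq_mul]
  filter_upwards [Lp.hasSum_coeFn_tsum hfin, hs, hc] with ω h1 h2 h3
  rw [hsum.tsum_eq] at h1
  simp only [h3, ← h2] at h1
  exact h1.tsum_eq

theorem represents_filt {α β : Type*} [Fintype β] (A : Matrix α β stableRing)
    {s : ℤ → Ω → β → ℝ} {σ : β → Sig (Lp ℝ 2 P)}
    (h : ∀ b, Represents P (fun t ω => s t ω b) (σ b)) (a : α) :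
    Represents P (fun t ω => filt (A.map Subtype.val) s t ω a) (matFilter A σ a) :=
  Represents.sum Finset.univ fun b _ => (h b).filter (A a b)

theorem Represents.timeAvg_mul {s w : ℤ → Ω → ℝ} {σ τ : Sig (Lp ℝ 2 P)} (hs : Represents P s σ)
    (hw : Represents P w τ) (N : ℕ) :
    timeAvg P (fun t ω => s t ω * w t ω) N = meanInner N σ τ := by
  rw [timeAvg, meanInner]
  congr 1
  refine Finset.sum_congr rfl fun t _ => ?_
  rw [L2.inner_def]
  refine integral_congr_ae ?_
  filter_upwards [hs t, hw t] with ω h1 h2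
  rw [h1, h2]
  simp [mul_comm]

theorem Represents.hasGenExp_iff {s w : ℤ → Ω → ℝ} {σ τ : Sig (Lp ℝ 2 P)} (hs : Represents P s σ)
    (hw : Represents P w τ) (n : ℤ) (r : ℝ) :
    HasGenExp P (fun t ω => s t ω * w (t - n) ω) r ↔
      Tendsto (fun N => meanInner N σ (shift n τ)) atTop (𝓝 r) := by
  rw [HasGenExp]
  exact tendsto_congr fun N => hs.timeAvg_mul (hw.delay n) N

theorem Represents.powerInner_eq {s w : ℤ → Ω → ℝ} {σ τ : Sig (Lp ℝ 2 P)} (hs : Represents P s σ)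
    (hw : Represents P w τ) {n : ℤ} {r : ℝ}
    (h : HasGenExp P (fun t ω => s t ω * w (t - n) ω) r) : powerInner σ (shift n τ) = r :=
  powerInner_eq_of_tendsto ((hs.hasGenExp_iff hw n r).1 h)

end Representation

/-! ### Existence of correlations of filtered signals -/

section Convergence

variable {E : Type*} [NormedAddCommGroup E] [InnerProductSpace ℝ E] [CompleteSpace E]

/-- The signals whose correlations with all members of `Z` exist at all lags. -/
noncomputable def correlationModule (Z : Set (Sig E)) : Submodule stableRing (Sig E) where
  carrier := {w | ∀ z ∈ Z, ∀ m n : ℤ, shift m w ∈ convergentWith (shift n z)}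
  add_mem' h h' z hz m n := by
    rw [map_add]
    exact add_mem (h z hz m n) (h' z hz m n)
  zero_mem' z _ m n := by
    rw [map_zero]
    exact zero_mem _
  smul_mem' F w h z hz m n := by
    rw [shift_stable_smul]
    refine stable_smul_mem (isClosed_convergentWith _) (fun k => ?_) F
    rw [shift_shift]
    exact h z hz _ n

theorem mem_convergentWith_of_span {Z : Set (Sig E)}
    (hZ : ∀ z ∈ Z, ∀ z' ∈ Z, ∀ n : ℤ, shift n z' ∈ convergentWith z) {s w : Sig E}
    (hs : s ∈ Submodule.span stableRing Z) (hw : w ∈ Submodule.span stableRing Z) :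
    w ∈ convergentWith s := by
  have h1 : Submodule.span stableRing Z ≤ correlationModule Z := by
    refine Submodule.span_le.2 fun z' hz' z hz m n => ?_
    obtain ⟨r, hr⟩ := hZ z hz z' hz' (m - n)
    exact ⟨r, tendsto_meanInner_shift hr⟩
  have h2 : Submodule.span stableRing Z ≤
      correlationModule (Submodule.span stableRing Z : Set (Sig E)) :=
    Submodule.span_le.2 fun z hz w hw m n => mem_convergentWith_comm.1 (h1 hw z hz n m)
  simpa using h2 hw s hs 0 0

end Convergence

/-! ### A nondegenerate spectrum excludes filtered dependencies -/

/-- A polynomial that vanishes at almost every point of the unit circle is zero. -/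
theorem polynomial_eq_zero_of_ae_circle (p : Polynomial ℝ)
    (h : ∀ᵐ w ∂(volume.restrict (Set.Ioc (-Real.pi) Real.pi)),
      Polynomial.aeval (Complex.exp (-(Complex.I * (w : ℝ)))) p = 0) : p = 0 := by
  by_contra hp
  have hp' : p.map (algebraMap ℝ ℂ) ≠ 0 := (Polynomial.map_ne_zero_iff
    (algebraMap ℝ ℂ).injective).2 hp
  have hinj : Set.InjOn (fun w : ℝ => Complex.exp (-(Complex.I * w)))
      (Set.Ioo (-Real.pi) Real.pi) := by
    intro a ha b hb hab
    have hlog : ∀ c ∈ Set.Ioo (-Real.pi) Real.pi,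
        Complex.log (Complex.exp (-(Complex.I * (c : ℝ)))) = -(Complex.I * c) := by
      intro c hc
      apply Complex.log_exp
      · simpa using hc.2
      · simp only [Complex.neg_im, Complex.mul_im, Complex.I_re, Complex.ofReal_im, mul_zero,
          Complex.I_im, Complex.ofReal_re, one_mul, zero_add]
        linarith [hc.1]
    have h1 := congrArg Complex.log hab
    simp only [hlog a ha, hlog b hb, neg_inj] at h1
    exact_mod_cast mul_left_cancel₀ Complex.I_ne_zero h1
  have hfin : Set.Finite {w : ℝ | w ∈ Set.Ioo (-Real.pi) Real.pi ∧
      Polynomial.aeval (Complex.exp (-(Complex.I * w))) p = 0} := by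
    refine Set.Finite.of_finite_image (f := fun w : ℝ => Complex.exp (-(Complex.I * w)))
      ((Finset.finite_toSet (p.map (algebraMap ℝ ℂ)).roots.toFinset).subset ?_)
      (hinj.mono fun w hw => hw.1)
    rintro _ ⟨w, hw, rfl⟩
    simp only [Finset.mem_coe, Multiset.mem_toFinset, Polynomial.mem_roots hp',
      Polynomial.IsRoot.def, Polynomial.eval_map_algebraMap]
    exact hw.2
  have hae : ∀ᵐ w ∂(volume.restrict (Set.Ioo (-Real.pi) Real.pi)), False := by
    have h1 := ae_restrict_of_ae_restrict_of_subset Set.Ioo_subset_Ioc_self h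
    have h2 : ∀ᵐ w ∂(volume.restrict (Set.Ioo (-Real.pi) Real.pi)),
        w ∉ {w : ℝ | w ∈ Set.Ioo (-Real.pi) Real.pi ∧
          Polynomial.aeval (Complex.exp (-(Complex.I * w))) p = 0} :=
      ae_restrict_of_ae (measure_eq_zero_iff_ae_notMem.1 (hfin.measure_zero volume))
    filter_upwards [h1, h2, ae_restrict_mem measurableSet_Ioo] with w a b c
    exact b ⟨c, a⟩
  rw [ae_iff] at hae
  simp only [not_false_eq_true, Set.ofPred_true, Measure.restrict_apply_univ, Real.volume_Ioo,
    ENNReal.ofReal_eq_zero] at hae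
  linarith [Real.pi_pos]

section Spectrum

variable {E : Type*} [NormedAddCommGroup E] [InnerProductSpace ℝ E] [CompleteSpace E]

/-- The power of a combination of polynomially filtered signals, by Parseval. -/
theorem powerInner_polyStable_eq_integral {ι : Type*} [Fintype ι] (σ : ι → Sig E)
    (Φ : ℝ → Matrix ι ι ℂ)
    (hint : ∀ k l, IntervalIntegrable (fun w => Φ w k l) volume (-Real.pi) Real.pi)
    (hcorr : ∀ (n : ℤ) (k l : ι), (powerInner (σ k) (shift n (σ l)) : ℂ) =
      (2 * Real.pi : ℂ)⁻¹ * ∫ w in (-Real.pi)..Real.pi, Φ w k l * Complex.exp (Complex.I * w * n))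
    (q : ι → Polynomial ℝ) :
    let Q : ℝ → ι → ℂ := fun w k => Polynomial.aeval (Complex.exp (-(Complex.I * w))) (q k)
    IntervalIntegrable (fun w => Q w ⬝ᵥ (Φ w).mulVec (star (Q w))) volume (-Real.pi) Real.pi ∧
    (powerInner (∑ k, polyStable (q k) • σ k) (∑ k, polyStable (q k) • σ k) : ℂ) =
      (2 * Real.pi : ℂ)⁻¹ * ∫ w in (-Real.pi)..Real.pi, Q w ⬝ᵥ (Φ w).mulVec (star (Q w)) := by
  intro Q
  have hterm : ∀ (k l : ι) (n : ℤ), IntervalIntegrable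
      (fun w : ℝ => Φ w k l * Complex.exp (Complex.I * w * n)) volume (-Real.pi) Real.pi :=
    fun k l n => (hint k l).mul_continuousOn (by fun_prop)
  have hQ : ∀ w : ℝ, Q w ⬝ᵥ (Φ w).mulVec (star (Q w)) =
      ∑ k, ∑ l, ∑ n ∈ (q k).support, ∑ m ∈ (q l).support,
        (((q k).coeff n * (q l).coeff m : ℝ) : ℂ) *
          (Φ w k l * Complex.exp (Complex.I * w * ((m : ℤ) - (n : ℤ) : ℤ))) := by
    intro w
    simp only [dotProduct, Matrix.mulVec, Finset.mul_sum]
    refine Finset.sum_congr rfl fun k _ => Finset.sum_congr rfl fun l _ => ?_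
    have hk : Q w k = ∑ n ∈ (q k).support,
        ((q k).coeff n : ℂ) * Complex.exp (-(Complex.I * w)) ^ n := by
      simp only [Q, Polynomial.aeval_def, Polynomial.eval₂_eq_sum,
        Polynomial.sum, Complex.coe_algebraMap]
    have hl : star (Q w) l = ∑ m ∈ (q l).support,
        ((q l).coeff m : ℂ) * Complex.exp (Complex.I * w) ^ m := by
      simp only [Pi.star_apply, Q, Polynomial.aeval_def, Polynomial.eval₂_eq_sum,
        Polynomial.sum, Complex.coe_algebraMap, RCLike.star_def, map_sum, map_mul, map_pow,
        Complex.conj_ofReal, ← Complex.exp_conj, map_neg, Complex.conj_I, neg_mul, neg_neg]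
    rw [hk, hl, Finset.sum_mul]
    refine Finset.sum_congr rfl fun n _ => ?_
    rw [Finset.mul_sum, Finset.mul_sum]
    refine Finset.sum_congr rfl fun m _ => ?_
    have hexp : Complex.exp (Complex.I * w * ((m : ℤ) - (n : ℤ) : ℤ)) =
        Complex.exp (-(Complex.I * w)) ^ n * Complex.exp (Complex.I * w) ^ m := by
      rw [← Complex.exp_nat_mul, ← Complex.exp_nat_mul, ← Complex.exp_add]
      congr 1
      push_cast
      ring
    rw [hexp]
    push_cast
    ring
  have hI : ∀ k l (n m : ℕ), IntervalIntegrable (fun w : ℝ =>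
      (((q k).coeff n * (q l).coeff m : ℝ) : ℂ) *
        (Φ w k l * Complex.exp (Complex.I * w * ((m : ℤ) - (n : ℤ) : ℤ)))) volume
      (-Real.pi) Real.pi := fun k l n m => (hterm k l _).const_mul _
  have hI1 : ∀ k l (n : ℕ), IntervalIntegrable (fun w : ℝ => ∑ m ∈ (q l).support,
      (((q k).coeff n * (q l).coeff m : ℝ) : ℂ) *
        (Φ w k l * Complex.exp (Complex.I * w * ((m : ℤ) - (n : ℤ) : ℤ)))) volume
      (-Real.pi) Real.pi := fun k l n => by
    simpa only [Finset.sum_fn] using IntervalIntegrable.sum _ fun m _ => hI k l n m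
  have hI2 : ∀ k l, IntervalIntegrable (fun w : ℝ => ∑ n ∈ (q k).support, ∑ m ∈ (q l).support,
      (((q k).coeff n * (q l).coeff m : ℝ) : ℂ) *
        (Φ w k l * Complex.exp (Complex.I * w * ((m : ℤ) - (n : ℤ) : ℤ)))) volume
      (-Real.pi) Real.pi := fun k l => by
    simpa only [Finset.sum_fn] using IntervalIntegrable.sum _ fun n _ => hI1 k l n
  have hI3 : ∀ k, IntervalIntegrable (fun w : ℝ => ∑ l, ∑ n ∈ (q k).support,
      ∑ m ∈ (q l).support, (((q k).coeff n * (q l).coeff m : ℝ) : ℂ) *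
        (Φ w k l * Complex.exp (Complex.I * w * ((m : ℤ) - (n : ℤ) : ℤ)))) volume
      (-Real.pi) Real.pi := fun k => by
    simpa only [Finset.sum_fn] using IntervalIntegrable.sum _ fun l _ => hI2 k l
  simp only [hQ]
  refine ⟨by simpa only [Finset.sum_fn] using IntervalIntegrable.sum _ fun k _ => hI3 k, ?_⟩
  rw [intervalIntegral.integral_finsetSum fun k _ => hI3 k, Finset.mul_sum]
  have hexpand : powerInner (∑ k, polyStable (q k) • σ k) (∑ k, polyStable (q k) • σ k) =
      ∑ k, ∑ l, ∑ n ∈ (q k).support, ∑ m ∈ (q l).support,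
        powerInner ((q k).coeff n • shift (n : ℤ) (σ k)) ((q l).coeff m • shift (m : ℤ) (σ l)) := by
    simp only [map_sum, sum_apply, polyStable_smul]
    refine (Finset.sum_congr rfl fun l _ => Finset.sum_comm).trans (Finset.sum_comm.trans ?_)
    exact Finset.sum_congr rfl fun k _ => Finset.sum_congr rfl fun l _ => Finset.sum_comm
  simp only [hexpand, Complex.ofReal_sum]
  refine Finset.sum_congr rfl fun k _ => ?_
  rw [intervalIntegral.integral_finsetSum fun l _ => hI2 k l, Finset.mul_sum]
  refine Finset.sum_congr rfl fun l _ => ?_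
  rw [intervalIntegral.integral_finsetSum fun n _ => hI1 k l n, Finset.mul_sum]
  refine Finset.sum_congr rfl fun n _ => ?_
  rw [intervalIntegral.integral_finsetSum fun m _ => hI k l n m, Finset.mul_sum]
  refine Finset.sum_congr rfl fun m _ => ?_
  rw [intervalIntegral.integral_const_mul]
  have hsh : powerInner (shift (n : ℤ) (σ k)) (shift (m : ℤ) (σ l)) =
      powerInner (σ k) (shift ((m : ℤ) - n) (σ l)) := by
    rw [powerInner_shift_left, shift_shift]
    congr 2
    ring_nf
  simp only [map_smul, smul_apply, smul_eq_mul, hsh]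
  push_cast
  have := hcorr ((m : ℤ) - n) k l
  push_cast at this
  rw [this]
  ring

/-- If the spectrum is positive definite almost everywhere, a nontrivial combination of stably
filtered components has positive power. -/
theorem eq_zero_of_isNull_of_posDef {ι : Type*} [Fintype ι] (σ : ι → Sig E)
    (Φ : ℝ → Matrix ι ι ℂ)
    (hint : ∀ k l, IntervalIntegrable (fun w => Φ w k l) volume (-Real.pi) Real.pi)
    (hcorr : ∀ (n : ℤ) (k l : ι), (powerInner (σ k) (shift n (σ l)) : ℂ) =
      (2 * Real.pi : ℂ)⁻¹ * ∫ w in (-Real.pi)..Real.pi, Φ w k l * Complex.exp (Complex.I * w * n))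
    (hpos : ∀ᵐ w ∂(volume.restrict (Set.Icc (-Real.pi) Real.pi)), (Φ w).PosDef)
    (a : ι → stableRing) (ha : IsNull (∑ k, a k • σ k)) : a = 0 := by
  obtain ⟨d, hd, hq⟩ := exists_common_denominator a
  choose q hq using hq
  have hnull : IsNull (∑ k, polyStable (q k) • σ k) := by
    have h := (orthFilterModule Set.univ).smul_mem (polyStable d)
      (isNull_iff_mem_orthSig_univ.1 ha)
    simp only [Finset.smul_sum, smul_smul, hq] at h
    exact isNull_iff_mem_orthSig_univ.2 h
  -- The power is the integral of a quadratic form in `Φ`, which is positive where `Q w ≠ 0`.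
  obtain ⟨hI, hP⟩ := powerInner_polyStable_eq_integral σ Φ hint hcorr q
  set Q : ℝ → ι → ℂ := fun w k => Polynomial.aeval (Complex.exp (-(Complex.I * w))) (q k)
  rw [show powerInner _ _ = 0 from hnull, Complex.ofReal_zero] at hP
  have hpi : (2 * Real.pi : ℂ)⁻¹ ≠ 0 := by
    simp [Real.pi_ne_zero]
  have hle : -Real.pi ≤ Real.pi := by linarith [Real.pi_pos]
  have hP0 := (mul_eq_zero.1 hP.symm).resolve_left hpi
  rw [intervalIntegral.integral_of_le hle] at hP0
  have hI' : IntegrableOn (fun w => Q w ⬝ᵥ (Φ w).mulVec (star (Q w)))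
      (Set.Ioc (-Real.pi) Real.pi) := (intervalIntegrable_iff_integrableOn_Ioc_of_le hle).1 hI
  have hre : ∫ w in Set.Ioc (-Real.pi) Real.pi,
      (Q w ⬝ᵥ (Φ w).mulVec (star (Q w))).re = 0 := by
    have := integral_re (𝕜 := ℂ) hI'
    simp only [RCLike.re_to_complex] at this
    rw [this, hP0, Complex.zero_re]
  have hpos' := ae_restrict_of_ae_restrict_of_subset
    (Set.Ioc_subset_Icc_self (a := -Real.pi) (b := Real.pi)) hpos
  have hnonneg : 0 ≤ᵐ[volume.restrict (Set.Ioc (-Real.pi) Real.pi)]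
      fun w => (Q w ⬝ᵥ (Φ w).mulVec (star (Q w))).re := by
    filter_upwards [hpos'] with w hw
    have := hw.posSemidef.dotProduct_mulVec_nonneg (star (Q w))
    rw [star_star] at this
    exact (Complex.le_def.1 this).1
  have hzero := (integral_eq_zero_iff_of_nonneg_ae hnonneg hI'.re).1 hre
  have hQ0 : ∀ᵐ w ∂(volume.restrict (Set.Ioc (-Real.pi) Real.pi)), Q w = 0 := by
    filter_upwards [hzero, hpos'] with w h0 hw
    by_contra hne
    have := hw.dotProduct_mulVec_pos (x := star (Q w)) (star_ne_zero.2 hne)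
    rw [star_star] at this
    exact (Complex.lt_def.1 this).1.ne' h0
  funext k
  have hk : q k = 0 := polynomial_eq_zero_of_ae_circle _ <| by
    filter_upwards [hQ0] with w hw
    exact congrFun hw k
  have := hq k
  rw [hk, map_zero] at this
  refine (mul_eq_zero.1 this).resolve_left fun h => hd (polyStable_injective ?_)
  rw [h, map_zero]

end Spectrum

/-! ### Elimination of the nodes behind a disconnecting set -/

section Elimination

variable {R M ι : Type*} [CommRing R] [IsDomain R] [AddCommGroup M] [Module R M]
  [Fintype ι] [DecidableEq ι]

/-- Consider the linear network `U = Γ U` in a module, valid at the nodes of `S`, all of whose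
inputs come from `S ∪ D`. If the network is well posed and the signals at `i` and `D` are linearly
independent, then a relation between the signals at `i`, `D` and `S` cannot involve `i`.

The subnetwork `S` alone need not be well posed. If it is, its signals are eliminated by Cramer's
rule. If it is not, a null vector of it gives a relation between the signals at `D`, which is
trivial by independence, hence a null vector of the whole network. -/
theorem coefficient_eq_zero_of_network (Γ : Matrix ι ι R) (hΓ : (1 - Γ).det ≠ 0)
    (D S : Finset ι) (i : ι) (hiD : i ∉ D) (hiS : i ∉ S) (U : ι → M)
    (hS : ∀ k ∈ S, ∀ l, Γ k l ≠ 0 → l ∈ S ∨ l ∈ D)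
    (hU : ∀ k ∈ S, U k = ∑ l, Γ k l • U l)
    (hind : ∀ a : ι → R, (∀ k ∉ insert i D, a k = 0) → ∑ k, a k • U k = 0 → a = 0)
    (b : ι → R) (hb : ∀ k, k ∉ insert i D → k ∉ S → b k = 0) (hbU : ∑ k, b k • U k = 0) :
    b i = 0 := by
  -- Row vectors on `S`, extended by zero, act on `1 - Γ` only in the columns `S ∪ D`.
  let N : Matrix S S R := 1 - Γ.submatrix Subtype.val Subtype.val
  let ext : (S → R) → ι → R := fun w k => if h : k ∈ S then w ⟨k, h⟩ else 0
  have ext_of_mem : ∀ w (k : S), ext w k = w k := fun w k => dif_pos k.2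
  have ext_of_notMem : ∀ w k, k ∉ S → ext w k = 0 := fun w k hk => dif_neg hk
  have row_mem : ∀ w (l : S),
      Matrix.vecMul (ext w) (1 - Γ : Matrix ι ι R) (l : ι) = Matrix.vecMul w N l := by
    intro w l
    simp only [Matrix.vecMul, dotProduct]
    rw [← Finset.sum_subset (Finset.subset_univ S) fun k _ hk => by
      rw [ext_of_notMem w k hk, zero_mul], ← Finset.sum_coe_sort S]
    refine Finset.sum_congr rfl fun k _ => ?_
    rw [ext_of_mem]
    simp only [N, Matrix.sub_apply, Matrix.one_apply, Matrix.submatrix_apply, Subtype.coe_inj]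
  have row_notMem : ∀ w l, l ∉ S → l ∉ D → Matrix.vecMul (ext w) (1 - Γ) l = 0 := by
    intro w l hlS hlD
    refine Finset.sum_eq_zero fun k _ => ?_
    by_cases hk : k ∈ S
    · have h1 : Γ k l = 0 := by
        by_contra h
        exact (hS k hk l h).elim hlS hlD
      have h2 : k ≠ l := fun h => hlS (h ▸ hk)
      simp [h1, Matrix.one_apply_ne h2]
    · rw [ext_of_notMem w k hk, zero_mul]
  have row_sum : ∀ w, ∑ l, Matrix.vecMul (ext w) (1 - Γ) l • U l = 0 := by
    intro w
    simp only [Matrix.vecMul, dotProduct, Finset.sum_smul, mul_smul]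
    rw [Finset.sum_comm]
    refine Finset.sum_eq_zero fun k _ => ?_
    rw [← Finset.smul_sum]
    by_cases hk : k ∈ S
    · simp [sub_smul, Finset.sum_sub_distrib, Matrix.one_apply, ite_smul, ← hU k hk]
    · rw [ext_of_notMem w k hk, zero_smul]
  by_cases hN : N.det = 0
  · exfalso
    obtain ⟨w, hw, hwN⟩ := Matrix.exists_vecMul_eq_zero_iff.2 hN
    refine hΓ (Matrix.exists_vecMul_eq_zero_iff.1 ⟨ext w, fun h => hw ?_, ?_⟩)
    · funext k
      rw [← ext_of_mem w k, h]
      rfl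
    · refine hind _ (fun l hl => ?_) (row_sum w)
      rw [Finset.mem_insert, not_or] at hl
      by_cases hlS : l ∈ S
      · rw [row_mem w ⟨l, hlS⟩, hwN]
        rfl
      · exact row_notMem w l hlS hl.2
  · let w : S → R := Matrix.vecMul (fun k : S => b k) N.adjugate
    have hw : Matrix.vecMul w N = fun k : S => N.det * b k := by
      rw [Matrix.vecMul_vecMul, Matrix.adjugate_mul, Matrix.vecMul_smul, Matrix.vecMul_one]
      rfl
    let c : ι → R := fun l => N.det * b l - Matrix.vecMul (ext w) (1 - Γ) l
    have hc : c = 0 := by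
      refine hind c (fun l hl => ?_) ?_
      · by_cases hlS : l ∈ S
        · change _ - Matrix.vecMul (ext w) (1 - Γ) l = 0
          rw [row_mem w ⟨l, hlS⟩, hw, sub_self]
        · have h1 := hb l hl hlS
          rw [Finset.mem_insert, not_or] at hl
          change _ - Matrix.vecMul (ext w) (1 - Γ) l = 0
          rw [row_notMem w l hlS hl.2, h1, mul_zero, sub_zero]
      · simp only [c, sub_smul, Finset.sum_sub_distrib, row_sum, mul_smul, ← Finset.smul_sum, hbU,
          smul_zero, sub_zero]
    have hci := congrFun hc i
    change N.det * b i - Matrix.vecMul (ext w) (1 - Γ) i = 0 at hci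
    rw [row_notMem w i hiS hiD, sub_zero] at hci
    exact (mul_eq_zero.1 hci).resolve_left hN

end Elimination

/-! ### The power of the prediction error -/

section PredictionError

variable {E : Type*} [NormedAddCommGroup E] [InnerProductSpace ℝ E] [CompleteSpace E]

/-- In open loop the contributions of the input and of the noise to the power of the error are
separate, and since `B` is monic the noise part is the innovation plus a filtered version of its
strict past, two uncorrelated signals. -/
theorem powerInner_error_eq {α β : Type*} [Fintype α] [Fintype β] [DecidableEq α]
    {U : β → Sig E} {W : α → Sig E}
    (hUW : ∀ (n : ℤ) k l, powerInner (U k) (shift n (W l)) = 0)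
    (hW : ∀ (n : ℕ), n ≠ 0 → ∀ k l, powerInner (W k) (shift (n : ℤ) (W l)) = 0)
    (A : Matrix α β stableRing) {B : Matrix α α stableRing} (hB : B.map feedthrough = 1) (k : α) :
    powerInner (matFilter A U k + matFilter B W k) (matFilter A U k + matFilter B W k) =
      powerInner (matFilter A U k) (matFilter A U k) + (powerInner (W k) (W k) +
        powerInner (matFilter (B - 1) W k) (matFilter (B - 1) W k)) := by
  -- `U` is orthogonal to the shifts of `W`, and filtering preserves both sides of the orthogonality.
  have hcross : powerInner (matFilter A U k) (matFilter B W k) = 0 := by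
    have hU : matFilter A U k ∈ orthFilterModule (Set.range W) := by
      refine matFilter_mem A (fun b => ?_) k
      rintro _ ⟨l, rfl⟩ n
      rw [powerInner_comm, hUW]
    have hW' : matFilter B W k ∈ orthFilterModule (orthSig (Set.range W) : Set (Sig E)) :=
      matFilter_mem B (fun b => mem_orthSig_orthSig (Set.mem_range_self b)) k
    simpa only [shift_zero] using hW' _ hU 0
  have hpast : powerInner (W k) (matFilter (B - 1) W k) = 0 := by
    change matFilter (B - 1) W k ∈ (powerInner (W k)).ker
    refine Submodule.sum_mem _ fun b _ => stable_smul_mem_of_impulse_zero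
      (ContinuousLinearMap.isClosed_ker _) (fun n hn => hW n hn k b) ?_
    rw [← feedthrough_apply, Matrix.sub_apply, map_sub]
    have h1 := congrFun (congrFun hB k) b
    rw [Matrix.map_apply] at h1
    rw [h1, Matrix.one_apply, Matrix.one_apply]
    split_ifs <;> simp
  have hsplit : matFilter B W k = W k + matFilter (B - 1) W k := by
    rw [matFilter_sub, matFilter_one, Pi.sub_apply, add_sub_cancel]
  rw [powerInner_add_self_of_eq_zero hcross, hsplit, powerInner_add_self_of_eq_zero hpast]

end PredictionError

section SumOfSquares

variable {Ω : Type*} [MeasurableSpace Ω] {P : Measure Ω}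

theorem timeAvg_sum_sq {ι : Type*} [Fintype ι] {s : ι → ℤ → Ω → ℝ} {σ : ι → Sig (Lp ℝ 2 P)}
    (h : ∀ k, Represents P (s k) (σ k)) (N : ℕ) :
    timeAvg P (fun t ω => ∑ k, s k t ω ^ 2) N = ∑ k, meanInner N (σ k) (σ k) := by
  have hint : ∀ k t, Integrable (fun ω => s k t ω ^ 2) P := fun k t =>
    ((memLp_congr_ae (h k t)).2 (Lp.memLp _)).integrable_sq
  simp only [← fun k => (h k).timeAvg_mul (h k) N, timeAvg, ← sq]
  rw [← Finset.mul_sum, Finset.sum_comm]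
  congr 1
  exact Finset.sum_congr rfl fun t _ => integral_finsetSum _ fun k _ => hint k t

end SumOfSquares

/-- The power of the prediction error at a model exists and splits into an input part, the
innovation, and a filtered past of the innovation. -/
theorem predError_power {Ω : Type*} [MeasurableSpace Ω] {P : Measure Ω} {p m : ℕ}
    {u : ℤ → Ω → Fin m → ℝ} {e y : ℤ → Ω → Fin p → ℝ}
    {U : Fin m → Sig (Lp ℝ 2 P)} {W : Fin p → Sig (Lp ℝ 2 P)}
    (hU : ∀ k, Represents P (fun t ω => u t ω k) (U k))
    (hW : ∀ k, Represents P (fun t ω => e t ω k) (W k))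
    (hconv : ∀ z ∈ Set.range (Sum.elim U W), ∀ z' ∈ Set.range (Sum.elim U W), ∀ n : ℤ,
      shift n z' ∈ convergentWith z)
    (hUW : ∀ (n : ℤ) k l, powerInner (U k) (shift n (W l)) = 0)
    (hWW : ∀ (n : ℕ), n ≠ 0 → ∀ k l, powerInner (W k) (shift (n : ℤ) (W l)) = 0)
    {G0 : Matrix (Fin p) (Fin m) (RatFunc ℝ)} {H0 : Matrix (Fin p) (Fin p) (RatFunc ℝ)}
    (hy : ∀ t, ∀ᵐ ω ∂P, y t ω = filt G0 u t ω + filt H0 e t ω)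
    {G0s Gs : Matrix (Fin p) (Fin m) stableRing} {H0s Hi : Matrix (Fin p) (Fin p) stableRing}
    (hG0 : G0s.map Subtype.val = G0) (hH0 : H0s.map Subtype.val = H0)
    {G : Matrix (Fin p) (Fin m) (RatFunc ℝ)} {H : Matrix (Fin p) (Fin p) (RatFunc ℝ)}
    (hG : Gs.map Subtype.val = G) (hH : Hi.map Subtype.val = H⁻¹)
    (hft : (Hi * H0s).map feedthrough = 1) :
    HasGenExp P (fun t ω => ∑ k, predError G H y u t ω k ^ 2)
      (∑ k, (powerInner (matFilter (Hi * (G0s - Gs)) U k) (matFilter (Hi * (G0s - Gs)) U k) +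
        (powerInner (W k) (W k) +
          powerInner (matFilter (Hi * H0s - 1) W k) (matFilter (Hi * H0s - 1) W k)))) := by
  let Y : Fin p → Sig (Lp ℝ 2 P) := matFilter G0s U + matFilter H0s W
  have hY : ∀ k, Represents P (fun t ω => y t ω k) (Y k) := by
    intro k
    refine ((represents_filt G0s hU k).add (represents_filt H0s hW k)).congr fun t => ?_
    filter_upwards [hy t] with ω hω
    rw [hω, hG0, hH0, Pi.add_apply]
  let ε : Fin p → Sig (Lp ℝ 2 P) := fun k =>
    matFilter (Hi * (G0s - Gs)) U k + matFilter (Hi * H0s) W k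
  have hε : ∀ k, Represents P (fun t ω => predError G H y u t ω k) (ε k) := by
    intro k
    have h := (hY k).sub ((represents_filt (1 - Hi) hY k).add (represents_filt (Hi * Gs) hU k))
    rw [map_val_sub, map_val_one, map_val_mul, hH, hG] at h
    have heq : ε k = Y k - (matFilter (1 - Hi) Y k + matFilter (Hi * Gs) U k) := by
      simp only [ε, Y, matFilter_mul, matFilter_sub, matFilter_sub_right, matFilter_add_right,
        matFilter_one, Pi.add_apply, Pi.sub_apply]
      abel
    rw [heq]
    exact h
  have hmem : ∀ k, ε k ∈ Submodule.span stableRing (Set.range (Sum.elim U W)) := fun k =>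
    add_mem
      (matFilter_mem _ (fun b => Submodule.subset_span
        (Set.mem_range_self (f := Sum.elim U W) (Sum.inl b))) k)
      (matFilter_mem _ (fun b => Submodule.subset_span
        (Set.mem_range_self (f := Sum.elim U W) (Sum.inr b))) k)
  refine Tendsto.congr (fun N => (timeAvg_sum_sq hε N).symm) ?_
  refine tendsto_finsetSum _ fun k _ => ?_
  rw [← powerInner_error_eq hUW hWW _ hft]
  exact tendsto_of_mem_convergentWith (mem_convergentWith_of_span hconv (hmem k) (hmem k))

/-! ### Identifiability from a relation of zero power -/

/-- A relation of zero power among the inputs at `i`, `D` and `T` cannot involve `i`. Modulo the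
closed span of the external signals that reach `T` around `D`, the inputs at `i` and `D` equal
their projections, which are independent, and the nodes that reach `T` around `D` form a network
driven by `D` alone. -/
theorem coefficient_eq_zero_of_isNull {E : Type*} [NormedAddCommGroup E] [InnerProductSpace ℝ E]
    [CompleteSpace E] {m nx : ℕ} {U : Fin m → Sig E} {X : Fin nx → Sig E}
    {Gu : Matrix (Fin m) (Fin m) (RatFunc ℝ)} (hGu : IsUnit (1 - Gu).det)
    {Γ : Matrix (Fin m) (Fin m) stableRing} (hΓ : Γ.map Subtype.val = Gu)
    {Ru : Matrix (Fin m) (Fin nx) ℝ}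
    (hU : ∀ k, U k = ∑ l, Γ k l • U l + ∑ l, Ru k l • X l)
    {i : Fin m} {D T : Finset (Fin m)} (hiD : i ∉ D)
    (hdis : ∀ l ∈ T, ¬ PathAvoiding (netEdge Gu Ru) (Sum.inl '' (D : Set (Fin m)))
      (Sum.inl i) (Sum.inl l))
    {V : ↥(insert i D) → Sig E}
    (hV : ∀ k, V k ∈ orthSig (X '' xStar Gu Ru D T))
    (hUV : ∀ k : ↥(insert i D), U k - V k ∈
      orthSig (orthSig (X '' xStar Gu Ru D T) : Set (Sig E)))
    (hind : ∀ a : ↥(insert i D) → stableRing, IsNull (∑ k, a k • V k) → a = 0)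
    {b : Fin m → stableRing} (hb : ∀ k, k ∉ insert i D → k ∉ T → b k = 0)
    (hbU : IsNull (∑ k, b k • U k)) : b i = 0 := by
  classical
  set Z : Set (Sig E) := X '' xStar Gu Ru D T
  let Wm : Submodule stableRing (Sig E) := orthFilterModule (orthSig Z : Set (Sig E))
  -- The nodes with a path to `T` around `D`; all their inputs come from `S`, `D` and `x_{T*}`.
  let S : Finset (Fin m) := Finset.univ.filter fun k => ∃ l ∈ T,
    PathAvoiding (netEdge Gu Ru) (Sum.inl '' (D : Set (Fin m))) (Sum.inl k) (Sum.inl l)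
  have hSmem : ∀ k, k ∈ S ↔ ∃ l ∈ T, PathAvoiding (netEdge Gu Ru)
      (Sum.inl '' (D : Set (Fin m))) (Sum.inl k) (Sum.inl l) := by
    intro k
    simp [S]
  have hTS : ∀ k ∈ T, k ∉ D → k ∈ S := fun k hk hkD =>
    (hSmem k).2 ⟨k, hk, by simpa using hkD, by simpa using hkD, .refl⟩
  have hstep : ∀ k ∈ S, ∀ a, a ∉ Sum.inl '' (D : Set (Fin m)) →
      netEdge Gu Ru a (Sum.inl k) → ∃ l ∈ T, PathAvoiding (netEdge Gu Ru)
        (Sum.inl '' (D : Set (Fin m))) a (Sum.inl l) := by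
    intro k hk a ha hak
    obtain ⟨l, hl, h1, h2, h3⟩ := (hSmem k).1 hk
    exact ⟨l, hl, ha, h2, .head ⟨hak, ha, h1⟩ h3⟩
  have hdet : (1 - Γ).det ≠ 0 := by
    intro h0
    have h1 := RingHom.map_det stableRing.subtype (1 - Γ)
    rw [h0, map_zero] at h1
    have h2 : stableRing.subtype.mapMatrix (1 - Γ) = 1 - Gu := by
      rw [← hΓ, ← map_val_one, ← map_val_sub]
      rfl
    rw [h2] at h1
    exact hGu.ne_zero h1.symm
  refine coefficient_eq_zero_of_network Γ hdet D S i hiD ?_ (fun k => Wm.mkQ (U k)) ?_ ?_ ?_ b ?_ ?_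
  · rw [hSmem]
    rintro ⟨l, hl, h⟩
    exact hdis l hl h
  · intro k hk l hkl
    by_cases hlD : l ∈ D
    · exact Or.inr hlD
    · refine Or.inl ((hSmem l).2 (hstep k hk _ (by simpa using hlD) ?_))
      change Gu k l ≠ 0
      rw [← hΓ]
      exact fun h => hkl (Subtype.ext h)
  · intro k hk
    have hX : ∑ l, Ru k l • X l ∈ Wm := by
      refine (orthSig (orthSig Z : Set (Sig E))).sum_mem fun l _ => ?_
      by_cases hl : Ru k l = 0
      · rw [hl, zero_smul]
        exact zero_mem _
      · exact Submodule.smul_mem _ _ (mem_orthSig_orthSig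
          ⟨l, hstep k hk (Sum.inr l) (by simp) hl, rfl⟩)
    simp only [← map_smul, ← map_sum]
    rw [← sub_eq_zero, ← map_sub, Submodule.mkQ_apply, Submodule.Quotient.mk_eq_zero]
    have h1 : U k - ∑ l, Γ k l • U l = ∑ l, Ru k l • X l := by
      conv_lhs => rw [hU k]
      exact add_sub_cancel_left _ _
    rwa [h1]
  · intro a ha hsum
    simp only [← map_smul, ← map_sum] at hsum
    rw [Submodule.mkQ_apply, Submodule.Quotient.mk_eq_zero] at hsum
    have h1 : ∑ k, a k • U k = ∑ k : ↥(insert i D), a k • U k := by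
      rw [Finset.sum_coe_sort (insert i D) fun k => a k • U k]
      exact (Finset.sum_subset (Finset.subset_univ _) fun k _ hk => by rw [ha k hk, zero_smul]).symm
    have h2 : ∑ k : ↥(insert i D), a k • V k ∈ Wm := by
      have h3 : ∑ k : ↥(insert i D), a k • (U k - V k) ∈ Wm :=
        Wm.sum_mem fun k _ => Wm.smul_mem _ (hUV k)
      rw [h1] at hsum
      have h4 := Wm.sub_mem hsum h3
      rw [← Finset.sum_sub_distrib] at h4
      simpa only [← smul_sub, sub_sub_cancel] using h4
    have h5 : ∑ k : ↥(insert i D), a k • V k ∈ orthFilterModule Z :=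
      Submodule.sum_mem _ fun k _ => Submodule.smul_mem _ _ (hV k)
    have h6 := hind (fun k => a k) (isNull_of_mem_orthSig h5 h2)
    funext k
    by_cases hk : k ∈ insert i D
    · exact congrFun h6 ⟨k, hk⟩
    · exact ha k hk
  · intro k hk hkS
    refine hb k hk fun hkT => hkS (hTS k hkT fun hkD => hk (Finset.mem_insert_of_mem hkD))
  · simp only [← map_smul, ← map_sum]
    rw [Submodule.mkQ_apply, Submodule.Quotient.mk_eq_zero]
    exact mem_orthSig_of_isNull hbU

/-! ### Identification of the target module -/

theorem theorem1 {Ω : Type*} [MeasurableSpace Ω] (P : Measure Ω) [IsProbabilityMeasure P]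
    {p m nx n : ℕ}
    -- the data generating system `y = G⁰ u + H⁰ e`
    (G0 : Matrix (Fin p) (Fin m) (RatFunc ℝ)) (H0 : Matrix (Fin p) (Fin p) (RatFunc ℝ))
    (hG0 : IsStableMatrix G0) (hH0 : IsNoiseModel H0)
    (u : ℤ → Ω → Fin m → ℝ) (e y : ℤ → Ω → Fin p → ℝ) (x : ℤ → Ω → Fin nx → ℝ)
    (he : IsWhiteNoise P e)
    (hy : ∀ t, ∀ᵐ ω ∂P, y t ω = filt G0 u t ω + filt H0 e t ω)
    (hqs : IsQuasiStationary P (fun t ω => Sum.elim (x t ω) (Sum.elim (u t ω) (e t ω))))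
    -- open loop
    (hue : Uncorrelated P u e)
    -- generation of the input: `u = G_u u + R_u x`
    (Gu : Matrix (Fin m) (Fin m) (RatFunc ℝ)) (hGu : IsStableMatrix Gu)
    (hGu_hollow : ∀ k, Gu k k = 0) (hGu_wellposed : IsUnit (1 - Gu).det)
    (Ru : Matrix (Fin m) (Fin nx) ℝ)
    (hRu : ∃ ρ : Fin nx ↪ Fin m, Ru = (1 : Matrix (Fin m) (Fin m) ℝ).submatrix id ρ)
    (hu : ∀ t, ∀ᵐ ω ∂P, u t ω = filt Gu u t ω + Ru.mulVec (x t ω))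
    (Φx : ℝ → Matrix (Fin nx) (Fin nx) ℂ) (hΦx : IsSpectrum P x Φx)
    (hΦx_diag : ∀ w, (Φx w).IsDiag) (hΦx_pos : ∀ w, (Φx w).PosDef)
    -- the model set, which contains the data generating system
    (Θ : Set (Fin n → ℝ))
    (G : (Fin n → ℝ) → Matrix (Fin p) (Fin m) (RatFunc ℝ))
    (H : (Fin n → ℝ) → Matrix (Fin p) (Fin p) (RatFunc ℝ))
    (hG : ∀ θ ∈ Θ, IsStableMatrix (G θ)) (hH : ∀ θ ∈ Θ, IsNoiseModel (H θ))
    (hsys : ∃ θ₀ ∈ Θ, G θ₀ = G0 ∧ H θ₀ = H0)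
    -- the target `G_ji`; the entries of row `j` outside the columns `Pu`, `Pe` are fixed
    (j : Fin p) (i : Fin m) (Pu : Finset (Fin m)) (Pe : Finset (Fin p)) (hi : i ∈ Pu)
    (hPu : ∀ k ∉ Pu, ∀ θ ∈ Θ, ∀ θ' ∈ Θ, G θ j k = G θ' j k)
    (hPe : ∀ l ∉ Pe, ∀ θ ∈ Θ, ∀ θ' ∈ Θ, H θ j l = H θ' j l)
    -- the disconnecting set and the remainder set
    (Dc T : Finset (Fin m)) (hiDc : i ∉ Dc)
    (hDc : IsDisconnecting (netEdge Gu Ru) (Sum.inl '' (Dc : Set (Fin m)))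
      {Sum.inl i} (Sum.inl '' ((Pu.erase i : Finset (Fin m)) : Set (Fin m))))
    (hT : T = Pu \ insert i Dc)
    -- row `j` is parametrized independently of the other rows, and in row `j` the columns of
    -- `u_i`, `u_Dc` are parametrized independently of those of `u_T`
    (hrow : IndepParam Θ (fun θ => (G θ j, H θ j))
      (fun θ (l : {l : Fin p // l ≠ j}) => (G θ l, H θ l)))
    (hcol : IndepParam Θ (fun θ (k : ↥(insert i Dc)) => G θ j k)
      (fun θ (k : T) => G θ j k))
    -- the projected inputs, and the spectrum of `μ`
    (v : ℤ → Ω → ↥(insert i Dc) → ℝ)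
    (hv : IsOrthProjection P (fun t ω (k : ↥(insert i Dc)) => u t ω k)
      x (xStar Gu Ru Dc T) v)
    (Φμ : ℝ → Matrix (↥(insert i Dc) ⊕ Pe) (↥(insert i Dc) ⊕ Pe) ℂ)
    (hΦμ : IsSpectrum P (fun t ω => Sum.elim (v t ω) (fun l : Pe => e t ω l)) Φμ)
    (hΦμ_pos : ∀ᵐ w ∂(volume.restrict (Set.Icc (-Real.pi) Real.pi)), (Φμ w).PosDef) :
    -- the cost `V(θ) = Ē ‖ε(t, θ)‖²` is well defined on `Θ`, the true system minimizes it, and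
    -- every minimizer has the true `G_ji`
    ∃ V : (Fin n → ℝ) → ℝ,
      (∀ θ ∈ Θ, HasGenExp P (fun t ω => ∑ k, (predError (G θ) (H θ) y u t ω k) ^ 2) (V θ)) ∧
      (∀ θ ∈ Θ, G θ = G0 → H θ = H0 → IsMinOn V Θ θ) ∧
      ∀ θ ∈ Θ, IsMinOn V Θ θ → G θ j i = G0 j i := by
  classical
  -- representation of all signals in the Hilbert space setting
  obtain ⟨Z, hZ⟩ := hqs.exists_represents
  let X : Fin nx → Sig (Lp ℝ 2 P) := fun k => Z (Sum.inl k)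
  let U : Fin m → Sig (Lp ℝ 2 P) := fun k => Z (Sum.inr (Sum.inl k))
  let W : Fin p → Sig (Lp ℝ 2 P) := fun k => Z (Sum.inr (Sum.inr k))
  have hX : ∀ k, Represents P (fun t ω => x t ω k) (X k) := fun k => hZ (Sum.inl k)
  have hU : ∀ k, Represents P (fun t ω => u t ω k) (U k) := fun k => hZ (Sum.inr (Sum.inl k))
  have hW : ∀ k, Represents P (fun t ω => e t ω k) (W k) := fun k => hZ (Sum.inr (Sum.inr k))
  obtain ⟨V, hV⟩ := hv.quasiStationary.exists_represents
  have hconv : ∀ z ∈ Set.range (Sum.elim U W), ∀ z' ∈ Set.range (Sum.elim U W), ∀ n : ℤ,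
      shift n z' ∈ convergentWith z := by
    have h : ∀ k l, ∀ n : ℤ, shift n (Z l) ∈ convergentWith (Z k) := fun k l n => by
      obtain ⟨r, hr⟩ := hqs.correlation n k l
      exact ⟨r, ((hZ k).hasGenExp_iff (hZ l) n r).1 hr⟩
    rintro _ ⟨k, rfl⟩ _ ⟨l, rfl⟩ n
    cases k <;> cases l <;> exact h _ _ n
  have hUW : ∀ (n : ℤ) k l, powerInner (U k) (shift n (W l)) = 0 := fun n k l =>
    (hU k).powerInner_eq (hW l) (hue n k l)
  have hWW : ∀ (n : ℕ), n ≠ 0 → ∀ k l, powerInner (W k) (shift (n : ℤ) (W l)) = 0 := by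
    intro n hn k l
    obtain ⟨Λ, hΛ⟩ := he.2.2
    refine (hW k).powerInner_eq (hW l) (tendsto_const_nhds.congr fun N => ?_)
    have h0 : ∀ t : ℤ, ∫ ω, e t ω k * e (t - n) ω l ∂P = 0 := fun t => by
      rw [hΛ, if_neg (by omega)]
    simp [timeAvg, h0]
  -- lifts to the ring of stable filters
  obtain ⟨G0s, hG0s⟩ := hG0.exists_lift
  obtain ⟨H0s, -, hH0s, -, -, -, hH0ft, -⟩ := hH0.exists_lift
  have hGlift : ∀ θ, ∃ A : Matrix (Fin p) (Fin m) stableRing,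
      θ ∈ Θ → A.map Subtype.val = G θ := fun θ => by
    by_cases hθ : θ ∈ Θ
    · obtain ⟨A, hA⟩ := (hG θ hθ).exists_lift
      exact ⟨A, fun _ => hA⟩
    · exact ⟨0, fun h => absurd h hθ⟩
  choose Gs hGs using hGlift
  have hHlift : ∀ θ, ∃ A B : Matrix (Fin p) (Fin p) stableRing, θ ∈ Θ →
      A.map Subtype.val = H θ ∧ B.map Subtype.val = (H θ)⁻¹ ∧ A * B = 1 ∧ B * A = 1 ∧
        A.map feedthrough = 1 ∧ B.map feedthrough = 1 := fun θ => by
    by_cases hθ : θ ∈ Θ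
    · obtain ⟨A, B, h⟩ := (hH θ hθ).exists_lift
      exact ⟨A, B, fun _ => h⟩
    · exact ⟨0, 0, fun h => absurd h hθ⟩
  choose Hs Hi hHs using hHlift
  let Vu : (Fin n → ℝ) → Fin p → ℝ := fun θ k =>
    powerInner (matFilter (Hi θ * (G0s - Gs θ)) U k) (matFilter (Hi θ * (G0s - Gs θ)) U k)
  let Ve : (Fin n → ℝ) → Fin p → ℝ := fun θ k =>
    powerInner (matFilter (Hi θ * H0s - 1) W k) (matFilter (Hi θ * H0s - 1) W k)
  let V0 : Fin p → ℝ := fun k => powerInner (W k) (W k)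
  have hVu : ∀ θ k, 0 ≤ Vu θ k := fun θ k => powerInner_self_nonneg _
  have hVe : ∀ θ k, 0 ≤ Ve θ k := fun θ k => powerInner_self_nonneg _
  have htrue : ∀ θ ∈ Θ, G θ = G0 → H θ = H0 →
      ∑ k, (Vu θ k + (V0 k + Ve θ k)) = ∑ k, V0 k := by
    intro θ hθ hGθ hHθ
    obtain ⟨h1, -, -, h4, -⟩ := hHs θ hθ
    have hG' : Gs θ = G0s := map_val_injective ((hGs θ hθ).trans (hGθ.trans hG0s.symm))
    have hH' : Hs θ = H0s := map_val_injective (h1.trans (hHθ.trans hH0s.symm))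
    rw [hH'] at h4
    refine Finset.sum_congr rfl fun k _ => ?_
    simp [Vu, Ve, h4, hG', matFilter]
  obtain ⟨θ₀, hθ₀, hGθ₀, hHθ₀⟩ := hsys
  refine ⟨fun θ => ∑ k, (Vu θ k + (V0 k + Ve θ k)), fun θ hθ => ?_, fun θ hθ hGθ hHθ θ' hθ' => ?_,
    fun θ hθ hmin => ?_⟩
  · obtain ⟨-, h2, -, -, -, h6⟩ := hHs θ hθ
    refine predError_power hU hW hconv hUW hWW hy hG0s hH0s (hGs θ hθ) h2 ?_
    have h := Matrix.map_mul (L := Hi θ) (M := H0s) (f := feedthrough)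
    rwa [h6, hH0ft, one_mul] at h
  · change ∑ k, (Vu θ k + (V0 k + Ve θ k)) ≤ ∑ k, (Vu θ' k + (V0 k + Ve θ' k))
    rw [htrue θ hθ hGθ hHθ]
    exact Finset.sum_le_sum fun k _ => by linarith [hVu θ' k, hVe θ' k]
  · -- at a minimizer the input part of the error has zero power
    have hle : ∑ k, (Vu θ k + (V0 k + Ve θ k)) ≤ ∑ k, (Vu θ₀ k + (V0 k + Ve θ₀ k)) := hmin hθ₀
    rw [htrue θ₀ hθ₀ hGθ₀ hHθ₀] at hle
    have hnull : ∀ k, IsNull (matFilter (Hi θ * (G0s - Gs θ)) U k) := by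
      have h1 : ∑ k, Vu θ k ≤ 0 := by
        simp only [Finset.sum_add_distrib] at hle
        linarith [Finset.sum_nonneg fun k (_ : k ∈ Finset.univ) => hVe θ k]
      have h2 := (Finset.sum_eq_zero_iff_of_nonneg fun k _ => hVu θ k).1
        (le_antisymm h1 (Finset.sum_nonneg fun k _ => hVu θ k))
      exact fun k => h2 k (Finset.mem_univ k)
    -- applying the stable filter `H(θ)` removes the inverse noise model
    have hnull' : IsNull (matFilter (G0s - Gs θ) U j) := by
      have h : matFilter (G0s - Gs θ) U = matFilter (Hs θ) (matFilter (Hi θ * (G0s - Gs θ)) U) := by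
        rw [← matFilter_mul, ← Matrix.mul_assoc, (hHs θ hθ).2.2.1, Matrix.one_mul]
      rw [h]
      exact isNull_iff_mem_orthSig_univ.2 (matFilter_mem (M := orthFilterModule Set.univ) _
        (fun b => isNull_iff_mem_orthSig_univ.1 (hnull b)) j)
    obtain ⟨Γ, hΓ⟩ := hGu.exists_lift
    have hUnet : ∀ k, U k = ∑ l, Γ k l • U l + ∑ l, Ru k l • X l := by
      intro k
      refine (hU k).unique ((represents_filt Γ hU k).add
        (Represents.sum Finset.univ fun l _ => (hX l).const_mul (Ru k l))) fun t => ?_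
      filter_upwards [hu t] with ω hω
      rw [hω, hΓ]
      rfl
    have hVorth : ∀ k, V k ∈ orthSig (X '' xStar Gu Ru Dc T) := by
      rintro k _ ⟨l, hl, rfl⟩ r
      rw [powerInner_comm]
      exact (hV k).powerInner_eq (hX l) (hv.orthogonal k l hl r)
    have hUV : ∀ k : ↥(insert i Dc), U k - V k ∈
        orthSig (orthSig (X '' xStar Gu Ru Dc T) : Set (Sig (Lp ℝ 2 P))) := by
      refine fun k => mem_orthSig_orthSig_of_approx fun δ hδ => ?_
      obtain ⟨c, hc⟩ := hv.closure k δ hδ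
      refine ⟨∑ b ∈ c.support, c b • shift b.2 (X b.1), Submodule.sum_mem _ fun b _ =>
        Submodule.smul_mem _ _ (shift_mem_orthSig
          (mem_orthSig_orthSig (Set.mem_image_of_mem X b.1.2)) _), ?_⟩
      have hrep := ((hU k).sub (hV k)).sub (Represents.sum c.support fun b _ =>
        ((hX b.1).delay b.2).const_mul (c b))
      refine le_of_tendsto (tendsto_powerInner _ _)
        ((hc.filter_mono Nat.hyperfilter_le_atTop).mono fun N hN => ?_)
      rw [← hrep.timeAvg_mul hrep N]
      simpa only [sq, Finsupp.sum] using hN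
    have hind : ∀ a : ↥(insert i Dc) → stableRing, IsNull (∑ k, a k • V k) → a = 0 := by
      intro a ha
      let σ : ↥(insert i Dc) ⊕ Pe → Sig (Lp ℝ 2 P) := Sum.elim V fun l => W l
      have hσ : ∀ k, Represents P
          (fun t ω => Sum.elim (v t ω) (fun l : Pe => e t ω l) k) (σ k) := by
        rintro (k | k)
        · exact hV k
        · exact hW k
      have h := eq_zero_of_isNull_of_posDef σ Φμ hΦμ.integrable (fun τ k l => by
        obtain ⟨r, hr, hr'⟩ := hΦμ.correlation τ k l
        rw [← hr', (hσ k).powerInner_eq (hσ l) hr]) hΦμ_pos (Sum.elim a 0)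
        (by simpa [σ] using ha)
      funext k
      exact congrFun h (Sum.inl k)
    have hfix : (G0s - Gs θ) j i = 0 := by
      refine coefficient_eq_zero_of_isNull hGu_wellposed hΓ hUnet hiDc (T := T) (fun l hl => ?_)
        hVorth hUV hind (b := fun k => (G0s - Gs θ) j k) (fun k hk hkT => ?_) hnull'
      · rw [hT, Finset.mem_sdiff, Finset.mem_insert, not_or] at hl
        exact hDc (Sum.inl i) rfl (Sum.inl l)
          ⟨l, by simpa using ⟨hl.1, hl.2.1⟩, rfl⟩
      · have hkP : k ∉ Pu := fun h => hkT (hT ▸ Finset.mem_sdiff.2 ⟨h, hk⟩)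
        have h := hPu k hkP θ₀ hθ₀ θ hθ
        rw [hGθ₀, ← hG0s, ← hGs θ hθ] at h
        exact sub_eq_zero.2 (Subtype.ext h)
    have h := congrArg Subtype.val (sub_eq_zero.1 hfix)
    rw [← hGs θ hθ, ← hG0s]
    exact h.symm
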